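/- Let $p$ be a prime and $S$ a finite $p$-group. A fusion system $\mathcal F$ on $S$ is a category whose objects are the subgroups of $S$ and whose morphisms $P\to Q$ are injective group homomorphisms, including all the maps $x\mapsto g^{-1}xg$ with $g\in S$, $g^{-1}Pg\le Q$, such that every morphism $P\to Q$ is an isomorphism of $\mathcal F$ from $P$ onto its image followed by the inclusion of the image into $Q$. Write $P^{\mathcal F}$ for the set of images of $P$ under morphisms in $\operatorname{Hom}_{\mathcal F}(P,S)$; its members are the $\mathcal F$-conjugates of $P$. Let $\operatorname{Aut}_{\mathcal F}(P)=\operatorname{Hom}_{\mathcal F}(P,P)$, let $\operatorname{Out}_{\mathcal F}(P)=\operatorname{Aut}_{\mathcal F}(P)/\operatorname{Inn}(P)$, and let $\operatorname{Aut}_S(P)$ be the group of automorphisms of $P$ induced by conjugation with elements of $N_S(P)$. The system $\mathcal F$ is saturated if every subgroup of $S$ has an $\mathcal F$-conjugate $Q$ such that $\operatorname{Aut}_S(Q)$ is a Sylow $p$-subgroup of $\operatorname{Aut}_{\mathcal F}(Q)$ and every $\mathcal F$-isomorphism $\alpha\colon R\to Q$, with $R\le S$, extends to a morphism in $\operatorname{Hom}_{\mathcal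 F}(N_\alpha,S)$, where $N_\alpha$ is the group of all $g\in N_S(R)$ such that conjugation with $g$ on $R$, transported to $Q$ by $\alpha$, lies in $\operatorname{Aut}_S(Q)$. A subgroup $Q\le S$ is $S$-centric if $C_S(Q)=Z(Q)$. A subgroup $P<S$ is $\mathcal F$-essential if every member of $P^{\mathcal F}$ is $S$-centric, $|N_S(P)|\ge|N_S(Q)|$ for all $Q\in P^{\mathcal F}$, and $\operatorname{Out}_{\mathcal F}(P)$ has a strongly $p$-embedded subgroup, that is, a proper subgroup $M$ of order divisible by $p$ such that $p\nmid|M\cap gMg^{-1}|$ for all $g\in\operatorname{Out}_{\mathcal F}(P)\setminus M$. For $P<S$ let $H_{\mathcal F}(P)\le\operatorname{Aut}_{\mathcal F}(P)$ be the subgroup generated by those $\mathcal F$-automorphisms of $P$ which extend to $\mathcal F$-isomorphisms between subgroups of $S$ strictly larger than $P$. **Lemma.** Let $\mathcal F$ be a saturated fusion system on $S$ and let $P$ be an $\mathcal F$-essential subgroup of $S$. Let $\mathcal C$ be a set of $\mathcal F$-conjugacy class representatives of $\mathcal F$-essential subgroups (that is, $\mathcal C$ consists of $\mathcal F$-essential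 subgroups, and every $\mathcal F$-essential subgroup is $\mathcal F$-conjugate to exactly one member of $\mathcal C$) with $P\in\mathcal C$. Assume that no proper subgroup of $P$ is $S$-centric. If $H_{\mathcal F}(P)\le K\le\operatorname{Aut}_{\mathcal F}(P)$, then the smallest fusion system on $S$ containing the indicated automorphisms, $$\mathcal G=\langle \operatorname{Aut}_{\mathcal F}(S),\,K,\,\operatorname{Aut}_{\mathcal F}(E)\mid E\in\mathcal C\setminus\{P\}\rangle,$$ is saturated. Furthermore, $P$ is $\mathcal G$-essential if and only if $K>H_{\mathcal F}(P)$, and in this case $\operatorname{Aut}_{\mathcal G}(P)=K$. -/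

import Mathlib

/-- A fusion system on a group `S`: a category whose objects are the subgroups of `S` and whose
morphisms are injective group homomorphisms, containing all the maps `x ↦ g⁻¹ x g` between
subgroups, and such that every morphism `P → Q` is an isomorphism of the category onto a subgroup
`R ≤ Q` (necessarily its image), followed by the inclusion. Identities and inclusions are morphisms
by `conj_mem` with `g = 1`. -/
structure FusionSystem (S : Type*) [Group S] where
  /-- the set of morphisms from `P` to `Q` -/
  Hom : (P Q : Subgroup S) → Set (P →* Q)
  injective : ∀ {P Q : Subgroup S} {φ : P →* Q}, φ ∈ Hom P Q → Function.Injective φ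
  comp_mem : ∀ {P Q R : Subgroup S} {φ : P →* Q} {ψ : Q →* R},
    φ ∈ Hom P Q → ψ ∈ Hom Q R → ψ.comp φ ∈ Hom P R
  conj_mem : ∀ {P Q : Subgroup S} (φ : P →* Q) (g : S),
    (∀ x : P, (φ x : S) = g⁻¹ * (x : S) * g) → φ ∈ Hom P Q
  factor : ∀ {P Q : Subgroup S} {φ : P →* Q}, φ ∈ Hom P Q →
    ∃ (R : Subgroup S) (hR : R ≤ Q) (e : P ≃* R),
      e.toMonoidHom ∈ Hom P R ∧ e.symm.toMonoidHom ∈ Hom R P ∧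
        φ = (Subgroup.inclusion hR).comp e.toMonoidHom

/-- `M` is a strongly `p`-embedded subgroup of `G`. -/
def IsStronglyPEmbedded (p : ℕ) {G : Type*} [Group G] (M : Subgroup G) : Prop :=
  M < ⊤ ∧ p ∣ Nat.card M ∧
    ∀ g : G, g ∉ M → ¬ p ∣ Nat.card (M ⊓ M.map (MulAut.conj g).toMonoidHom : Subgroup G)

namespace FusionSystem

variable {S : Type*} [Group S]

theorem symm_mem (F : FusionSystem S) {P Q : Subgroup S} {e : P ≃* Q}
    (he : e.toMonoidHom ∈ F.Hom P Q) : e.symm.toMonoidHom ∈ F.Hom Q P := by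
  obtain ⟨R, hR, e', -, h2, h3⟩ := F.factor he
  have key : ∀ x, e x = Subgroup.inclusion hR (e' x) := fun x => DFunLike.congr_fun h3 x
  have hRQ : R = Q := by
    refine le_antisymm hR fun y hy => ?_
    have h := key (e.symm ⟨y, hy⟩)
    rw [MulEquiv.apply_symm_apply] at h
    have h' : y = (e' (e.symm ⟨y, hy⟩) : S) := congrArg Subtype.val h
    rw [h']
    exact (e' _).2
  subst hRQ
  have : e = e' := MulEquiv.ext fun x => key x
  rw [this]
  exact h2

/-- `Aut_F(P)`, as a group of automorphisms of `P`. -/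
def Aut (F : FusionSystem S) (P : Subgroup S) : Subgroup (MulAut P) where
  carrier := {α | (MulEquiv.toMonoidHom α) ∈ F.Hom P P}
  one_mem' := F.conj_mem _ 1 fun x => by simp
  mul_mem' := fun {_ _} ha hb => F.comp_mem hb ha
  inv_mem' := fun {_} ha => F.symm_mem ha

/-- The intersection of a family of fusion systems on `S` (the system of all injective
homomorphisms if the family is empty). -/
def inter (X : Set (FusionSystem S)) : FusionSystem S where
  Hom P Q := {φ | Function.Injective φ ∧ ∀ G ∈ X, φ ∈ G.Hom P Q}
  injective h := h.1
  comp_mem h₁ h₂ := ⟨h₂.1.comp h₁.1, fun G hG => G.comp_mem (h₁.2 G hG) (h₂.2 G hG)⟩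
  conj_mem φ g h := by
    refine ⟨fun x y hxy => ?_, fun G _ => G.conj_mem φ g h⟩
    have h1 : (φ x : S) = φ y := by rw [hxy]
    rw [h, h] at h1
    exact Subtype.ext (mul_left_cancel (mul_right_cancel h1))
  factor {P Q φ} h := by
    have hφ : Function.Injective (Q.subtype.comp φ) := Q.subtype_injective.comp h.1
    have hR : (Q.subtype.comp φ).range ≤ Q := by
      rintro _ ⟨x, rfl⟩
      exact (φ x).2
    have key : ∀ G ∈ X, (MonoidHom.ofInjective hφ).toMonoidHom ∈
        G.Hom P (Q.subtype.comp φ).range := by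
      intro G hG
      obtain ⟨R, hRQ, e, h1, -, h3⟩ := G.factor (h.2 G hG)
      have hRR : R = (Q.subtype.comp φ).range := by
        ext y
        constructor
        · intro hy
          refine ⟨e.symm ⟨y, hy⟩, ?_⟩
          rw [h3]
          simp
        · rintro ⟨x, rfl⟩
          rw [h3]
          exact (e x).2
      subst hRR
      have : MonoidHom.ofInjective hφ = e :=
        MulEquiv.ext fun x => Subtype.ext (congrArg Subtype.val (DFunLike.congr_fun h3 x) :)
      rw [this]
      exact h1
    refine ⟨_, hR, MonoidHom.ofInjective hφ, ⟨(MonoidHom.ofInjective hφ).injective, key⟩,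
      ⟨(MonoidHom.ofInjective hφ).symm.injective, fun G hG => G.symm_mem (key G hG)⟩, ?_⟩
    ext x
    rfl

/-- The fusion system on `S` generated by a set `X` of automorphisms of subgroups of `S`: the
smallest fusion system on `S` in which all members of `X` are morphisms. -/
def generate (X : Set (Σ Q : Subgroup S, MulAut Q)) : FusionSystem S :=
  inter {G | ∀ x ∈ X, x.2 ∈ G.Aut x.1}

/-- `Aut_S(P)`: the automorphisms of `P` induced by conjugation with elements of `N_S(P)`. -/
def autS (P : Subgroup S) : Subgroup (MulAut P) :=
  P.normalizerMonoidHom.range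

/-- `Inn(P)`. -/
def inn (P : Subgroup S) : Subgroup (MulAut P) :=
  (MulAut.conj : P →* MulAut P).range

instance inn_normal (P : Subgroup S) : (inn P).Normal where
  conj_mem := by
    rintro _ ⟨x, rfl⟩ α
    refine ⟨α x, ?_⟩
    ext y
    simp

/-- `Out_F(P) = Aut_F(P) / Inn(P)`. -/
abbrev Out (F : FusionSystem S) (P : Subgroup S) : Type _ :=
  F.Aut P ⧸ (inn P).subgroupOf (F.Aut P)

/-- `P` and `Q` are `F`-conjugate: `Q` is the image of `P` under a morphism of `F`. -/
def IsConj (F : FusionSystem S) (P Q : Subgroup S) : Prop :=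
  ∃ e : P ≃* Q, e.toMonoidHom ∈ F.Hom P Q

def IsFullyNormalized (F : FusionSystem S) (P : Subgroup S) : Prop :=
  ∀ Q : Subgroup S, F.IsConj P Q →
    Nat.card (Subgroup.normalizer (Q : Set S)) ≤ Nat.card (Subgroup.normalizer (P : Set S))

/-- `Aut_S(P)` is a Sylow `p`-subgroup of `Aut_F(P)`. -/
def IsFullyAutomized (p : ℕ) (F : FusionSystem S) (P : Subgroup S) : Prop :=
  ∃ T : Sylow p (F.Aut P), (T : Subgroup (F.Aut P)).map (F.Aut P).subtype = autS P

/-- `P` is `S`-centric: `C_S(P) = Z(P)`. -/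
def IsSCentric (P : Subgroup S) : Prop :=
  Subgroup.centralizer (P : Set S) = (Subgroup.center P).map P.subtype

def IsCentric (F : FusionSystem S) (P : Subgroup S) : Prop :=
  ∀ Q : Subgroup S, F.IsConj P Q → IsSCentric Q

/-- For an isomorphism `e : P → Q`, the group of all `g ∈ N_S(P)` for which conjugation with `g`
on `P`, transported to `Q` along `e`, lies in `Aut_S(Q)`. -/
def extControl {P Q : Subgroup S} (e : P ≃* Q) : Subgroup S :=
  ((autS Q).comap ((MulAut.congr e).toMonoidHom.comp P.normalizerMonoidHom)).map
    (Subgroup.normalizer (P : Set S)).subtype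

theorem le_extControl {P Q : Subgroup S} (e : P ≃* Q) : P ≤ extControl e := by
  intro x hx
  refine ⟨⟨x, Subgroup.le_normalizer hx⟩,
    ⟨⟨e ⟨x, hx⟩, Subgroup.le_normalizer (e ⟨x, hx⟩).2⟩, ?_⟩, rfl⟩
  ext y
  have h : (⟨x, hx⟩ : P) * e.symm y * (⟨x, hx⟩ : P)⁻¹ =
      P.normalizerMonoidHom ⟨x, Subgroup.le_normalizer hx⟩ (e.symm y) := by
    ext
    rfl
  change _ = ((e (P.normalizerMonoidHom ⟨x, Subgroup.le_normalizer hx⟩ (e.symm y)) : Q) : S)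
  rw [← h]
  simp only [map_mul, map_inv, MulEquiv.apply_symm_apply]
  rfl

/-- Every `F`-isomorphism `e : P → Q` extends to an `F`-morphism `N_e → S`. -/
def IsReceptive (F : FusionSystem S) (Q : Subgroup S) : Prop :=
  ∀ (P : Subgroup S) (e : P ≃* Q), e.toMonoidHom ∈ F.Hom P Q →
    ∃ φ ∈ F.Hom (extControl e) ⊤,
      ∀ x : P, (φ (Subgroup.inclusion (le_extControl e) x) : S) = e x

def IsSaturated (p : ℕ) (F : FusionSystem S) : Prop :=
  ∀ P : Subgroup S, ∃ Q : Subgroup S,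
    F.IsConj P Q ∧ F.IsFullyAutomized p Q ∧ F.IsReceptive Q

def IsEssential (p : ℕ) (F : FusionSystem S) (P : Subgroup S) : Prop :=
  P < ⊤ ∧ F.IsCentric P ∧ F.IsFullyNormalized P ∧
    ∃ M : Subgroup (F.Out P), IsStronglyPEmbedded p M

/-- `H_F(P)`: generated by the `F`-automorphisms of `P` which extend to `F`-isomorphisms between
strictly larger subgroups of `S`. -/
def extAut (F : FusionSystem S) (P : Subgroup S) : Subgroup (MulAut P) :=
  Subgroup.closure {α | α ∈ F.Aut P ∧
    ∃ (R R' : Subgroup S) (hR : P < R) (_ : P < R') (e : R ≃* R'),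
      e.toMonoidHom ∈ F.Hom R R' ∧
        ∀ x : P, (e (Subgroup.inclusion hR.le x) : S) = α x}

/-- `C` is a set of representatives of the `F`-conjugacy classes of `F`-essential subgroups. -/
def IsEssentialReps (p : ℕ) (F : FusionSystem S) (C : Set (Subgroup S)) : Prop :=
  (∀ E ∈ C, F.IsEssential p E) ∧
    ∀ E : Subgroup S, F.IsEssential p E → ∃! E' : Subgroup S, E' ∈ C ∧ F.IsConj E E'

/-- `⟨Aut_F(S), K, Aut_F(E) ∣ E ∈ C \ {P}⟩`. -/
def prune (F : FusionSystem S) (C : Set (Subgroup S)) (P : Subgroup S)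
    (K : Subgroup (MulAut P)) : FusionSystem S :=
  generate (Sigma.mk ⊤ '' (F.Aut ⊤ : Set (MulAut (⊤ : Subgroup S))) ∪
    Sigma.mk P '' (K : Set (MulAut P)) ∪
    ⋃ E ∈ C \ {P}, Sigma.mk E '' (F.Aut E : Set (MulAut E)))

end FusionSystem

/-!
Let `𝒢` be the pruned system. By induction on the index, as in Alperin's fusion theorem, `F` and `𝒢`
have the same isomorphisms between `F`-centric subgroups that are not `F`-conjugate to `P`: a fully
normalized subgroup that is not essential has `Aut_F = H_F`, which comes from larger subgroups, and
since no proper subgroup of `P` is `S`-centric, conjugates of `P` never occur among the subgroups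
above an `F`-centric one. Saturation therefore passes from `F` to `𝒢` at the `F`-centric subgroups.

At a subgroup `X` that is not `F`-centric, all generators of `𝒢` are defined on strictly larger
subgroups. Hence the morphisms between `𝒢`-conjugates of `X` are generated by those that extend, and
saturation at `X` follows from saturation at the larger subgroups, because some `𝒢`-conjugate `Y` of
`X` satisfies `C_S(Y) ≰ Y`, so that morphisms can be extended to `Y C_S(Y)`.

For `Aut_𝒢(P) = K`, move the `F`-conjugates of `P` to `P` along morphisms defined on their
normalizers. This is unique up to `H_F(P) ≤ K`, and it turns each generator of `𝒢` into an element
of `K`. Finally, `H_F(P)` contains `Aut_S(P)` and every `F`-automorphism of `P` that conjugates an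
element of `Aut_S(P)` outside `Inn(P)` into `Aut_S(P)`, so `H_F(P) / Inn(P)` is strongly
`p`-embedded in `K / Inn(P)` when `H_F(P) < K`. If `H_F(P) = K`, then every generator of `K` does
conjugate such an element into `Aut_S(P)`, so a strongly `p`-embedded subgroup would be everything.
-/

section GroupTheory

variable {Γ Δ : Type*} [Group Γ] [Group Δ] {p : ℕ}

/-- `x` is a `p`-element: its order is a power of `p`. -/
def IsPElement (p : ℕ) (x : Γ) : Prop :=
  ∃ k : ℕ, x ^ p ^ k = 1

theorem IsPElement.isPGroup_zpowers {x : Γ} (hx : IsPElement p x) :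
    IsPGroup p (Subgroup.zpowers x) := by
  obtain ⟨k, hk⟩ := hx
  rintro ⟨_, n, rfl⟩
  refine ⟨k, Subtype.ext ?_⟩
  change (x ^ n) ^ p ^ k = 1
  rw [← zpow_natCast, zpow_comm, zpow_natCast, hk, one_zpow]

theorem IsPElement.map {x : Γ} (hx : IsPElement p x) (f : Γ →* Δ) : IsPElement p (f x) := by
  obtain ⟨k, hk⟩ := hx
  exact ⟨k, by rw [← map_pow, hk, map_one]⟩

theorem isPElement_of_mem {T : Subgroup Γ} (hT : IsPGroup p T) {x : Γ} (hx : x ∈ T) :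
    IsPElement p x := by
  obtain ⟨k, hk⟩ := hT ⟨x, hx⟩
  exact ⟨k, congrArg Subtype.val hk⟩

/-- `T` is a Sylow `p`-subgroup of the subgroup `B`, both regarded inside an ambient group. -/
def IsSylowIn (p : ℕ) (T B : Subgroup Γ) : Prop :=
  ∃ T' : Sylow p B, (T' : Subgroup B).map B.subtype = T

theorem exists_isSylowIn (p : ℕ) (B : Subgroup Γ) : ∃ T, IsSylowIn p T B :=
  ⟨_, default, rfl⟩

theorem isPGroup_subgroupOf {D : Subgroup Γ} (hD : IsPGroup p D) (B : Subgroup Γ) :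
    IsPGroup p (D.subgroupOf B) :=
  hD.comap_of_injective B.subtype B.subtype_injective

theorem mem_iff_of_map_subtype_eq {A B : Subgroup Γ} {T : Subgroup B} (hT : T.map B.subtype = A)
    {x : B} : x ∈ T ↔ (x : Γ) ∈ A :=
  hT ▸ (Subgroup.mem_map_iff_mem B.subtype_injective).symm

namespace IsSylowIn

variable {T B B' D : Subgroup Γ}

theorem le (h : IsSylowIn p T B) : T ≤ B := by
  obtain ⟨T', rfl⟩ := h
  exact Subgroup.map_subtype_le _

theorem isPGroup (h : IsSylowIn p T B) : IsPGroup p T := by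
  obtain ⟨T', rfl⟩ := h
  exact T'.isPGroup'.map _

section Prime

variable [Fact p.Prime] [Finite Γ]

theorem map_range (h : IsSylowIn p T B) (f : B →* Δ) :
    IsSylowIn p ((T.subgroupOf B).map f) f.range := by
  obtain ⟨T', rfl⟩ := h
  refine ⟨T'.mapSurjective f.rangeRestrict_surjective, ?_⟩
  rw [Sylow.coe_mapSurjective, Subgroup.map_map, f.subtype_comp_rangeRestrict, Subgroup.subgroupOf,
    Subgroup.comap_map_eq_self_of_injective B.subtype_injective]

theorem map (h : IsSylowIn p T B) (f : Γ →* Δ) : IsSylowIn p (T.map f) (B.map f) := by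
  have hf := h.map_range (f.comp B.subtype)
  rwa [← Subgroup.map_map, Subgroup.subgroupOf_map_subtype, inf_eq_left.2 h.le,
    MonoidHom.range_comp, Subgroup.range_subtype] at hf

theorem exists_conj (h : IsSylowIn p T B) (hD : D ≤ B) (hpD : IsPGroup p D) :
    ∃ b ∈ B, D.map (MulAut.conj b).toMonoidHom ≤ T := by
  obtain ⟨T', rfl⟩ := h
  obtain ⟨Q, hQ⟩ := (isPGroup_subgroupOf hpD B).exists_le_sylow
  obtain ⟨b, rfl⟩ := MulAction.exists_smul_eq B Q T'
  refine ⟨b, b.2, ?_⟩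
  rintro _ ⟨d, hd, rfl⟩
  exact ⟨b * ⟨d, hD hd⟩ * b⁻¹, Subgroup.smul_mem_pointwise_smul _ (MulAut.conj b) _
    (hQ (show (⟨d, hD hd⟩ : B) ∈ _ from hd)), rfl⟩

theorem card_le (h : IsSylowIn p T B) (hD : D ≤ B) (hpD : IsPGroup p D) :
    Nat.card D ≤ Nat.card T := by
  obtain ⟨b, -, hb⟩ := h.exists_conj hD hpD
  rw [← Subgroup.card_map_of_injective (f := (MulAut.conj b).toMonoidHom) (MulAut.conj b).injective]
  exact Subgroup.card_le_of_le hb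

end Prime

variable [Finite Γ]

theorem of_card_le (hT : T ≤ B) (hpT : IsPGroup p T)
    (hcard : ∀ D ≤ B, IsPGroup p D → Nat.card D ≤ Nat.card T) : IsSylowIn p T B := by
  have hmap : (T.subgroupOf B).map B.subtype = T := by
    rw [Subgroup.subgroupOf_map_subtype, inf_eq_left.2 hT]
  refine ⟨⟨T.subgroupOf B, isPGroup_subgroupOf hpT B, fun {Q} hQ hle => ?_⟩, hmap⟩
  have h1 := hcard (Q.map B.subtype) (Subgroup.map_subtype_le Q) (hQ.map _)
  rw [← hmap, Subgroup.card_map_of_injective B.subtype_injective,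
    Subgroup.card_map_of_injective B.subtype_injective] at h1
  exact (Subgroup.eq_of_le_of_card_ge hle h1).symm

variable [Fact p.Prime]

theorem mono (h : IsSylowIn p T B) (hT : T ≤ B') (hB : B' ≤ B) : IsSylowIn p T B' :=
  of_card_le hT h.isPGroup fun _ hD => h.card_le (hD.trans hB)

theorem exists_conj_inf (h : IsSylowIn p T B) (hD : D ≤ B) :
    ∃ b ∈ B, IsSylowIn p (T ⊓ D.map (MulAut.conj b).toMonoidHom)
      (D.map (MulAut.conj b).toMonoidHom) := by
  obtain ⟨D₀, hD₀⟩ := exists_isSylowIn p D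
  obtain ⟨b, hb, hconj⟩ := h.exists_conj (hD₀.le.trans hD) hD₀.isPGroup
  have hle := le_inf hconj (Subgroup.map_mono hD₀.le)
  refine ⟨b, hb, of_card_le inf_le_right (h.isPGroup.to_le inf_le_left) fun E hE hpE => ?_⟩
  exact ((hD₀.map (MulAut.conj b).toMonoidHom).card_le hE hpE).trans (Subgroup.card_le_of_le hle)

end IsSylowIn

theorem lt_inf_normalizer [Fact p.Prime] {R M : Subgroup Γ} [Finite M] (hM : IsPGroup p M)
    (h : R < M) : R < M ⊓ Subgroup.normalizer (R : Set Γ) := by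
  have := hM.isNilpotent
  have hlt : R.subgroupOf M < ⊤ := by
    rw [lt_top_iff_ne_top, Ne, Subgroup.subgroupOf_eq_top]
    exact not_le_of_gt h
  obtain ⟨x, hx, hxR⟩ := SetLike.exists_of_lt (Group.normalizerCondition_of_isNilpotent _ hlt)
  refine lt_of_le_of_ne (le_inf h.le Subgroup.le_normalizer) fun heq => hxR ?_
  rw [Subgroup.mem_subgroupOf, heq]
  refine ⟨x.2, Subgroup.mem_normalizer_iff.2 fun g => ?_⟩
  rw [Subgroup.mem_normalizer_iff] at hx
  refine ⟨fun hg => (hx ⟨g, h.le hg⟩).1 hg, fun hg => ?_⟩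
  have hgM : g ∈ M := by
    simpa [mul_assoc] using M.mul_mem (M.mul_mem (M.inv_mem x.2) (h.le hg)) x.2
  exact (hx ⟨g, hgM⟩).2 hg

/-- `H` represents a strongly `p`-embedded subgroup of the quotient by a normal `p`-subgroup `N`;
the condition on intersections of conjugates is expressed by means of `p`-elements. -/
structure IsStronglyPEmbeddedMod (p : ℕ) (N H : Subgroup Γ) : Prop where
  ne_top : H ≠ ⊤
  exists_isPElement : ∃ x ∈ H, x ∉ N ∧ IsPElement p x
  mem_of_conj_mem {x g : Γ} : x ∈ H → x ∉ N → IsPElement p x → g * x * g⁻¹ ∈ H → g ∈ H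

section Quotient

variable [Fact p.Prime] {N H T : Subgroup Γ}

theorem IsStronglyPEmbeddedMod.isPGroup_le [Finite T] (h : IsStronglyPEmbeddedMod p N H)
    (hT : IsPGroup p T) {x : Γ} (hxT : x ∈ T) (hxH : x ∈ H) (hxN : x ∉ N) : T ≤ H := by
  by_contra hle
  obtain ⟨g, ⟨hgT, hg⟩, hgH⟩ := SetLike.exists_of_lt (lt_inf_normalizer hT (inf_lt_left.2 hle))
  have hconj : g * x * g⁻¹ ∈ T ⊓ H := (Subgroup.mem_normalizer_iff.1 hg x).1 ⟨hxT, hxH⟩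
  exact hgH ⟨hgT, h.mem_of_conj_mem hxH hxN (isPElement_of_mem hT hxT) hconj.2⟩

variable [Finite Γ] [N.Normal]

theorem dvd_card_subgroup_quotient_iff (hN : IsPGroup p N) (L : Subgroup (Γ ⧸ N)) :
    p ∣ Nat.card L ↔ ∃ x : Γ, (x : Γ ⧸ N) ∈ L ∧ x ∉ N ∧ IsPElement p x := by
  constructor
  · intro h
    obtain ⟨⟨y, hy⟩, hord⟩ := exists_prime_orderOf_dvd_card' p h
    rw [Subgroup.orderOf_mk] at hord
    obtain ⟨x, rfl⟩ := QuotientGroup.mk_surjective y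
    obtain ⟨k, hk⟩ : IsPElement p (x ^ p) := by
      refine isPElement_of_mem hN ((QuotientGroup.eq_one_iff _).1 ?_)
      rw [QuotientGroup.mk_pow, ← hord, pow_orderOf_eq_one]
    refine ⟨x, hy, fun hx => ?_, k + 1, by rw [pow_succ', pow_mul, hk]⟩
    rw [(QuotientGroup.eq_one_iff x).2 hx, orderOf_one] at hord
    exact (Fact.out : p.Prime).one_lt.ne hord
  · rintro ⟨x, hx, hxN, hpx⟩
    obtain ⟨k, hk⟩ := hpx.map (QuotientGroup.mk' N)
    obtain ⟨j, -, hj⟩ := (Nat.dvd_prime_pow Fact.out).1 (orderOf_dvd_of_pow_eq_one hk)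
    have hj0 : j ≠ 0 := by
      rintro rfl
      rw [pow_zero, orderOf_eq_one_iff] at hj
      exact hxN ((QuotientGroup.eq_one_iff x).1 hj)
    exact ((dvd_pow_self p hj0).trans hj.symm.dvd).trans (Subgroup.orderOf_dvd_natCard L hx)

theorem isStronglyPEmbedded_quotient_iff (hN : IsPGroup p N) (M : Subgroup (Γ ⧸ N)) :
    IsStronglyPEmbedded p M ↔ IsStronglyPEmbeddedMod p N (M.comap (QuotientGroup.mk' N)) := by
  have hinf (g x : Γ) : (x : Γ ⧸ N) ∈ M ⊓ M.map (MulAut.conj (g : Γ ⧸ N)).toMonoidHom ↔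
      (x : Γ ⧸ N) ∈ M ∧ ((g⁻¹ * x * g : Γ) : Γ ⧸ N) ∈ M := by
    rw [Subgroup.mem_inf]
    refine and_congr_right fun _ => ⟨?_, fun h => ⟨_, h, by simp [mul_assoc]⟩⟩
    rintro ⟨y, hy, hyx⟩
    have : ((g⁻¹ * x * g : Γ) : Γ ⧸ N) = y := by
      rw [QuotientGroup.mk_mul, QuotientGroup.mk_mul, ← hyx]
      simp [mul_assoc]
    rwa [this]
  constructor
  · rintro ⟨hM, hdvd, hint⟩
    refine ⟨fun h => hM.ne ?_, (dvd_card_subgroup_quotient_iff hN M).1 hdvd,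
      fun {x g} hx hxN hpx hgx => by_contra fun hg => ?_⟩
    · exact Subgroup.comap_injective (QuotientGroup.mk'_surjective N) h
    · refine hint ((g⁻¹ : Γ) : Γ ⧸ N) (fun h => hg ?_) ((dvd_card_subgroup_quotient_iff hN _).2
        ⟨x, (hinf _ _).2 ⟨hx, by simpa using hgx⟩, hxN, hpx⟩)
      simpa using h
  · rintro ⟨hM, hex, hint⟩
    refine ⟨lt_top_iff_ne_top.2 fun h => hM ?_, (dvd_card_subgroup_quotient_iff hN M).2 hex,
      fun g hg hdvd => ?_⟩
    · rw [h, Subgroup.comap_top]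
    · obtain ⟨g, rfl⟩ := QuotientGroup.mk_surjective g
      obtain ⟨x, hxM, hxN, hpx⟩ := (dvd_card_subgroup_quotient_iff hN _).1 hdvd
      obtain ⟨hx, hgx⟩ := (hinf g x).1 hxM
      exact hg (by simpa using hint (g := g⁻¹) hx hxN hpx (by simpa using hgx))

theorem isStronglyPEmbedded_of_controls (hN : IsPGroup p N) (T : Sylow p Γ) (hTH : T ≤ H)
    (hNH : N ≤ H) (hNT : ∃ x ∈ T, x ∉ N) (hH : H ≠ ⊤)
    (hfus : ∀ g, ∀ x ∈ T, x ∉ N → g * x * g⁻¹ ∈ T → g ∈ H) :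
    IsStronglyPEmbedded p (H.map (QuotientGroup.mk' N)) := by
  have hconj {x : Γ} (hx : x ∈ H) (hpx : IsPElement p x) : ∃ h ∈ H, h * x * h⁻¹ ∈ T := by
    have hT : IsSylowIn p (T : Subgroup Γ) H :=
      ⟨T.subtype hTH, by rw [Sylow.coe_subtype, Subgroup.subgroupOf_map_subtype, inf_eq_left.2 hTH]⟩
    obtain ⟨h, hh, hc⟩ := hT.exists_conj (Subgroup.zpowers_le.2 hx) hpx.isPGroup_zpowers
    exact ⟨h, hh, hc ⟨x, Subgroup.mem_zpowers x, rfl⟩⟩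
  rw [isStronglyPEmbedded_quotient_iff hN, Subgroup.comap_map_eq, QuotientGroup.ker_mk',
    sup_eq_left.2 hNH]
  refine ⟨hH, ?_, fun {x g} hx hxN hpx hgx => ?_⟩
  · obtain ⟨x, hxT, hxN⟩ := hNT
    exact ⟨x, hTH hxT, hxN, isPElement_of_mem T.isPGroup' hxT⟩
  · obtain ⟨a, ha, hax⟩ := hconj hx hpx
    obtain ⟨b, hb, hbx⟩ := hconj hgx (hpx.map (MulAut.conj g).toMonoidHom)
    have hmem : b * g * a⁻¹ ∈ H := by
      refine hfus _ (a * x * a⁻¹) hax (fun h => hxN ?_) (by simpa [mul_assoc] using hbx)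
      simpa [mul_assoc] using ‹N.Normal›.conj_mem _ h a⁻¹
    simpa [mul_assoc] using H.mul_mem (H.mul_mem (H.inv_mem hb) hmem) ha

theorem not_isStronglyPEmbedded_of_closure_eq_top (hN : IsPGroup p N) (T : Sylow p Γ) {s : Set Γ}
    (hs : Subgroup.closure s = ⊤) (hfus : ∀ g ∈ s, ∃ x ∈ T, x ∉ N ∧ g * x * g⁻¹ ∈ T)
    (M : Subgroup (Γ ⧸ N)) : ¬ IsStronglyPEmbedded p M := by
  rw [isStronglyPEmbedded_quotient_iff hN]
  intro hM
  set H := M.comap (QuotientGroup.mk' N)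
  obtain ⟨x, hxH, hxN, hpx⟩ := hM.exists_isPElement
  obtain ⟨Q, hQ⟩ := hpx.isPGroup_zpowers.exists_le_sylow
  obtain ⟨c, rfl⟩ := MulAction.exists_smul_eq Γ T Q
  have hTH {t : Γ} (ht : t ∈ T) : c * t * c⁻¹ ∈ H :=
    hM.isPGroup_le (c • T).isPGroup' (hQ (Subgroup.mem_zpowers x)) hxH hxN
      (Subgroup.smul_mem_pointwise_smul _ (MulAut.conj c) _ ht)
  have hsH : Subgroup.closure s ≤ H.comap (MulAut.conj c).toMonoidHom := by
    refine (Subgroup.closure_le _).2 fun g hg => ?_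
    obtain ⟨t, ht, htN, hgt⟩ := hfus g hg
    refine hM.mem_of_conj_mem (hTH ht) (fun h => htN ?_)
      ((isPElement_of_mem T.isPGroup' ht).map (MulAut.conj c).toMonoidHom) ?_
    · simpa [mul_assoc] using ‹N.Normal›.conj_mem _ h c⁻¹
    · simpa [mul_assoc] using hTH hgt
  refine hM.ne_top (Subgroup.comap_injective (f := (MulAut.conj c).toMonoidHom)
    (MulAut.conj c).surjective ?_)
  exact top_le_iff.1 (hs.ge.trans hsH)

end Quotient

end GroupTheory

namespace FusionSystem

variable {S : Type*} [Group S]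

local notation "N[" X "]" => Subgroup.normalizer (X : Set S)
local notation "C[" X "]" => Subgroup.centralizer (X : Set S)
local notation "c[" g "]" => MulEquiv.toEquiv (MulAut.conj g)

section Iso

/-- Fusion systems on `S` are ordered by inclusion of their sets of morphisms. -/
instance : LE (FusionSystem S) where
  le F G := ∀ X Y, F.Hom X Y ⊆ G.Hom X Y

/-- The permutation `σ` of `S` restricts to an isomorphism `X → Y` of `F`. Morphisms are encoded by
permutations of all of `S` in order that restriction and composition need no change of types; the
values of `σ` outside of `X` are irrelevant. -/
def Iso (F : FusionSystem S) (X Y : Subgroup S) (σ : Equiv.Perm S) : Prop :=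
  ∃ e : X ≃* Y, e.toMonoidHom ∈ F.Hom X Y ∧ ∀ x : X, σ x = e x

namespace Iso

variable {F G : FusionSystem S} {X Y Z A B V W X' Y' R R' : Subgroup S} {σ τ : Equiv.Perm S}

theorem mono (hFG : F ≤ G) (h : F.Iso X Y σ) : G.Iso X Y σ := by
  obtain ⟨e, he, hσ⟩ := h
  exact ⟨e, hFG X Y he, hσ⟩

theorem mem_iff (h : F.Iso X Y σ) {s : S} : σ s ∈ Y ↔ s ∈ X := by
  obtain ⟨e, -, he⟩ := h
  refine ⟨fun hs => ?_, fun hs => he ⟨s, hs⟩ ▸ (e _).2⟩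
  obtain ⟨x, hx⟩ := e.surjective ⟨σ s, hs⟩
  have h1 : σ x = σ s := by rw [he, hx]
  exact σ.injective h1 ▸ x.2

theorem map_mul (h : F.Iso X Y σ) {x y : S} (hx : x ∈ X) (hy : y ∈ X) :
    σ (x * y) = σ x * σ y := by
  obtain ⟨e, -, he⟩ := h
  have := congrArg Subtype.val (_root_.map_mul e ⟨x, hx⟩ ⟨y, hy⟩)
  rw [← he] at this
  simpa [← he] using this

theorem map_one (h : F.Iso X Y σ) : σ 1 = 1 := by
  simpa using h.map_mul X.one_mem X.one_mem

theorem map_inv (h : F.Iso X Y σ) {x : S} (hx : x ∈ X) : σ x⁻¹ = (σ x)⁻¹ := by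
  rw [eq_inv_iff_mul_eq_one, ← h.map_mul (X.inv_mem hx) hx, inv_mul_cancel, h.map_one]

theorem map_conj (h : F.Iso X Y σ) {x y : S} (hx : x ∈ X) (hy : y ∈ X) :
    σ (x * y * x⁻¹) = σ x * σ y * (σ x)⁻¹ := by
  rw [h.map_mul (X.mul_mem hx hy) (X.inv_mem hx), h.map_mul hx hy, h.map_inv hx]

theorem congr (h : F.Iso X Y σ) (hτ : ∀ x ∈ X, τ x = σ x) : F.Iso X Y τ := by
  obtain ⟨e, he, h1⟩ := h
  exact ⟨e, he, fun x => (hτ x x.2).trans (h1 x)⟩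

theorem trans (h : F.Iso X Y σ) (h' : F.Iso Y Z τ) : F.Iso X Z (τ * σ) := by
  obtain ⟨e, he, h1⟩ := h
  obtain ⟨e', he', h1'⟩ := h'
  refine ⟨e.trans e', F.comp_mem he he', fun x => ?_⟩
  rw [Equiv.Perm.mul_apply, h1, h1']
  rfl

theorem symm (h : F.Iso X Y σ) : F.Iso Y X σ⁻¹ := by
  obtain ⟨e, he, h1⟩ := h
  refine ⟨e.symm, F.symm_mem he, fun y => ?_⟩
  rw [Equiv.Perm.inv_eq_iff_eq, h1, MulEquiv.apply_symm_apply]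

theorem exists_apply_eq (h : F.Iso X Y σ) {y : S} (hy : y ∈ Y) : ∃ x ∈ X, σ x = y := by
  obtain ⟨e, -, he⟩ := h
  obtain ⟨x, hx⟩ := e.surjective ⟨y, hy⟩
  exact ⟨x, x.2, by rw [he, hx]⟩

theorem inv_mem_iff (h : F.Iso X Y σ) {s : S} : σ⁻¹ s ∈ X ↔ s ∈ Y :=
  h.symm.mem_iff

theorem right_unique (h : F.Iso X Y σ) (h' : F.Iso X Y' σ) : Y = Y' := by
  ext y
  rw [← h.inv_mem_iff, h'.inv_mem_iff]

theorem card_eq (h : F.Iso X Y σ) : Nat.card X = Nat.card Y := by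
  obtain ⟨e, -, -⟩ := h
  exact Nat.card_congr e.toEquiv

theorem isConj (h : F.Iso X Y σ) : F.IsConj X Y := by
  obtain ⟨e, he, -⟩ := h
  exact ⟨e, he⟩

theorem of_hom {φ : X →* Y} (hφ : φ ∈ F.Hom X Y) (hσ : ∀ s, σ s ∈ Y ↔ s ∈ X)
    (h : ∀ x : X, σ x = φ x) : F.Iso X Y σ := by
  have hs : Function.Surjective φ := fun y =>
    ⟨⟨σ⁻¹ y, by simp [← hσ]⟩, Subtype.ext (by simp [← h])⟩
  exact ⟨MulEquiv.ofBijective φ ⟨F.injective hφ, hs⟩, hφ, h⟩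

theorem conj (F : FusionSystem S) (g : S) (h : ∀ s, g * s * g⁻¹ ∈ Y ↔ s ∈ X) :
    F.Iso X Y c[g] := by
  let φ : X →* Y :=
    { toFun := fun x => ⟨g * x * g⁻¹, (h x).2 x.2⟩
      map_one' := by ext; simp
      map_mul' := fun x y => by ext; simp }
  exact of_hom (φ := φ) (F.conj_mem φ g⁻¹ fun x => by simp [φ]) h fun x => rfl

theorem refl (F : FusionSystem S) (X : Subgroup S) : F.Iso X X 1 :=
  (conj F 1 (by simp)).congr (by simp)

theorem restrict (h : F.Iso R R' σ) (hX : X ≤ R) (hXY : ∀ s, σ s ∈ Y ↔ s ∈ X) :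
    F.Iso X Y σ := by
  obtain ⟨e, he, h1⟩ := h
  have hi : Subgroup.inclusion hX ∈ F.Hom X R := F.conj_mem _ 1 fun x => by simp
  obtain ⟨W, hW, f, hf, -, hf'⟩ := F.factor (F.comp_mem hi he)
  have h2 : F.Iso X W σ := ⟨f, hf, fun x =>
    (h1 ⟨x, hX x.2⟩).trans (congrArg Subtype.val (DFunLike.congr_fun hf' x) :)⟩
  have hWY : W = Y := by
    ext y
    rw [← h2.inv_mem_iff, ← hXY, Equiv.Perm.coe_inv, Equiv.apply_symm_apply]
  exact hWY ▸ h2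

theorem exists_restrict (h : F.Iso R R' σ) (hX : X ≤ R) : ∃ Y ≤ R', F.Iso X Y σ := by
  let Y : Subgroup S :=
    { carrier := σ '' X
      one_mem' := ⟨1, X.one_mem, h.map_one⟩
      mul_mem' := by
        rintro _ _ ⟨x, hx, rfl⟩ ⟨y, hy, rfl⟩
        exact ⟨x * y, X.mul_mem hx hy, h.map_mul (hX hx) (hX hy)⟩
      inv_mem' := by
        rintro _ ⟨x, hx, rfl⟩
        exact ⟨x⁻¹, X.inv_mem hx, h.map_inv (hX hx)⟩ }
  refine ⟨Y, ?_, h.restrict hX fun s => σ.injective.mem_set_image⟩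
  rintro _ ⟨x, hx, rfl⟩
  exact h.mem_iff.2 (hX hx)

theorem le_of_le (h : F.Iso X Y σ) (h' : F.Iso R R' σ) (hX : X ≤ R) : Y ≤ R' :=
  fun _ hy => h'.inv_mem_iff.1 (hX (h.inv_mem_iff.2 hy))

theorem lt_of_lt (h : F.Iso X Y σ) (h' : F.Iso R R' σ) (hX : X < R) : Y < R' :=
  lt_of_le_not_ge (h.le_of_le h' hX.le) fun hY => hX.not_ge (h'.symm.le_of_le h.symm hY)

theorem le_of_sup (h : F.Iso (A ⊔ B) W σ) (hA : ∀ a ∈ A, σ a ∈ V) (hB : ∀ b ∈ B, σ b ∈ V) :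
    W ≤ V := by
  obtain ⟨U, -, hU⟩ := h.symm.exists_restrict (inf_le_right : V ⊓ W ≤ W)
  have hmem {s : S} (hs : s ∈ A ⊔ B) (hsV : σ s ∈ V) : s ∈ U :=
    hU.symm.mem_iff.1 ⟨hsV, h.mem_iff.2 hs⟩
  have hAB : A ⊔ B ≤ U := sup_le (fun a ha => hmem (le_sup_left (a := A) ha) (hA a ha))
    fun b hb => hmem (le_sup_right (b := B) hb) (hB b hb)
  exact (h.le_of_le hU.symm hAB).trans inf_le_left

theorem conj_self_iff {g : S} : F.Iso X X c[g] ↔ g ∈ N[X] :=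
  ⟨fun h => Subgroup.mem_normalizer_iff.2 fun _ => h.mem_iff.symm,
    fun hg => conj F g fun s => (Subgroup.mem_normalizer_iff.1 hg s).symm⟩

theorem map_mem_normalizer (h : F.Iso R R' σ) (hX : X ≤ R) (h' : F.Iso X Y σ) {s : S}
    (hs : s ∈ R) (hsX : s ∈ N[X]) : σ s ∈ N[Y] := by
  refine conj_self_iff.1 (((h'.symm.trans (conj_self_iff.2 hsX)).trans h').congr fun y hy => ?_)
  obtain ⟨x, hx, rfl⟩ := h'.exists_apply_eq hy
  simpa using (h.map_conj hs (hX hx)).symm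

theorem mem_normalizer_iff (h : F.Iso R R' σ) (hX : X ≤ R) (h' : F.Iso X Y σ) {s : S}
    (hs : s ∈ R) : σ s ∈ N[Y] ↔ s ∈ N[X] := by
  refine ⟨fun hsY => ?_, h.map_mem_normalizer hX h' hs⟩
  simpa using h.symm.map_mem_normalizer (h'.le_of_le h hX) h'.symm (h.mem_iff.2 hs) hsY

theorem map_mem_centralizer (h : F.Iso R R' σ) (hX : X ≤ R) (h' : F.Iso X Y σ) {s : S}
    (hs : s ∈ R) (hsX : s ∈ C[X]) : σ s ∈ C[Y] := by
  refine Subgroup.mem_centralizer_iff.2 fun y hy => ?_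
  obtain ⟨x, hx, rfl⟩ := h'.exists_apply_eq hy
  rw [← h.map_mul (hX hx) hs, Subgroup.mem_centralizer_iff.1 hsX x hx, h.map_mul hs (hX hx)]

theorem le_normalizer (h : F.Iso R R' σ) (h' : F.Iso X Y σ) (hX : X ≤ R) (hR : R ≤ N[X]) :
    R' ≤ N[Y] := by
  intro y hy
  obtain ⟨r, hr, rfl⟩ := h.exists_apply_eq hy
  exact h.map_mem_normalizer hX h' hr (hR hr)

end Iso

end Iso

section IsConj

variable {F : FusionSystem S} {X Y Z : Subgroup S}

theorem IsConj.refl (F : FusionSystem S) (X : Subgroup S) : F.IsConj X X :=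
  (Iso.refl F X).isConj

theorem IsConj.symm (h : F.IsConj X Y) : F.IsConj Y X := by
  obtain ⟨e, he⟩ := h
  exact ⟨e.symm, F.symm_mem he⟩

theorem IsConj.trans (h : F.IsConj X Y) (h' : F.IsConj Y Z) : F.IsConj X Z := by
  obtain ⟨e, he⟩ := h
  obtain ⟨e', he'⟩ := h'
  exact ⟨e.trans e', F.comp_mem he he'⟩

theorem IsConj.card_eq (h : F.IsConj X Y) : Nat.card X = Nat.card Y := by
  obtain ⟨e, -⟩ := h
  exact Nat.card_congr e.toEquiv

variable [Finite S]

theorem exists_iso_of_mulEquiv {e : X ≃* Y} (he : e.toMonoidHom ∈ F.Hom X Y) :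
    ∃ σ, F.Iso X Y σ ∧ ∀ x : X, σ x = e x := by
  classical
  have := Fintype.ofFinite S
  have hσ (x : X) : (e.toEquiv.extendSubtype : Equiv.Perm S) x = e x :=
    e.toEquiv.extendSubtype_apply_of_mem x x.2
  exact ⟨_, ⟨e, he, hσ⟩, hσ⟩

theorem exists_iso_of_hom {φ : X →* Y} (hφ : φ ∈ F.Hom X Y) :
    ∃ σ, ∃ W ≤ Y, F.Iso X W σ ∧ ∀ x : X, σ x = φ x := by
  obtain ⟨W, hW, e, he, -, rfl⟩ := F.factor hφ
  obtain ⟨σ, hσ, hσe⟩ := exists_iso_of_mulEquiv he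
  exact ⟨σ, W, hW, hσ, hσe⟩

theorem IsConj.exists_iso (h : F.IsConj X Y) : ∃ σ, F.Iso X Y σ := by
  obtain ⟨e, he⟩ := h
  obtain ⟨σ, hσ, -⟩ := exists_iso_of_mulEquiv he
  exact ⟨σ, hσ⟩

end IsConj

section ExtendAut

variable {F : FusionSystem S} {X : Subgroup S} {σ : Equiv.Perm S} {α : MulAut X}

/-- The permutation of `S` that is `α` on `X` and the identity elsewhere. -/
noncomputable def extendAut {X : Subgroup S} (α : MulAut X) : Equiv.Perm S :=
  open Classical in Equiv.Perm.ofSubtype (p := (· ∈ X)) α.toEquiv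

theorem extendAut_apply (α : MulAut X) (x : X) : extendAut α x = α x := by
  classical
  exact Equiv.Perm.ofSubtype_apply_coe (p := (· ∈ X)) α.toEquiv x

theorem iso_of_mem_aut (hα : α ∈ F.Aut X) (h : ∀ x : X, σ x = α x) : F.Iso X X σ :=
  ⟨α, hα, h⟩

theorem Iso.exists_aut (h : F.Iso X X σ) : ∃ α ∈ F.Aut X, ∀ x : X, σ x = α x := by
  obtain ⟨e, he, h⟩ := h
  exact ⟨e, he, h⟩

theorem Iso.mem_aut (h : F.Iso X X σ) (hα : ∀ x : X, σ x = α x) : α ∈ F.Aut X := by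
  obtain ⟨e, he, h⟩ := h
  have : α = e := MulEquiv.ext fun x => Subtype.ext ((hα x).symm.trans (h x))
  exact this ▸ he

theorem iso_extendAut_iff : F.Iso X X (extendAut α) ↔ α ∈ F.Aut X :=
  ⟨fun h => h.mem_aut (extendAut_apply α), fun h => iso_of_mem_aut h (extendAut_apply α)⟩

end ExtendAut

section IsNormalizerConj

variable {F : FusionSystem S} {X Y Z V W : Subgroup S} {σ : Equiv.Perm S}

/-- `F`-conjugacy of `X` and `Y` along a morphism of `F` that is defined on the normalizer of `X`.
This relation is not symmetric. -/
def IsNormalizerConj (F : FusionSystem S) (X Y : Subgroup S) : Prop :=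
  ∃ σ W, F.Iso X Y σ ∧ F.Iso N[X] W σ

theorem Iso.isNormalizerConj (h : F.Iso X Y σ) (h' : F.Iso V W σ) (hV : N[X] ≤ V) :
    F.IsNormalizerConj X Y := by
  obtain ⟨W', -, hW'⟩ := h'.exists_restrict hV
  exact ⟨σ, W', h, hW'⟩

namespace IsNormalizerConj

theorem refl (F : FusionSystem S) (X : Subgroup S) : F.IsNormalizerConj X X :=
  ⟨1, _, Iso.refl F X, Iso.refl F _⟩

theorem trans (h : F.IsNormalizerConj X Y) (h' : F.IsNormalizerConj Y Z) :
    F.IsNormalizerConj X Z := by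
  obtain ⟨σ, W, hσ, hσN⟩ := h
  obtain ⟨τ, V, hτ, hτN⟩ := h'
  obtain ⟨V', -, hV'⟩ := hτN.exists_restrict (hσN.le_normalizer hσ Subgroup.le_normalizer le_rfl)
  exact ⟨τ * σ, V', hσ.trans hτ, hσN.trans hV'⟩

theorem isConj (h : F.IsNormalizerConj X Y) : F.IsConj X Y := by
  obtain ⟨σ, W, hσ, -⟩ := h
  exact hσ.isConj

theorem exists_iso_normalizer [Finite S] (h : F.IsNormalizerConj X Y)
    (hc : Nat.card N[Y] ≤ Nat.card N[X]) : ∃ σ, F.Iso X Y σ ∧ F.Iso N[X] N[Y] σ := by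
  obtain ⟨σ, W, hσ, hσN⟩ := h
  have hW : W ≤ N[Y] := hσN.le_normalizer hσ Subgroup.le_normalizer le_rfl
  rw [hσN.card_eq] at hc
  exact ⟨σ, hσ, Subgroup.eq_of_le_of_card_ge hW hc ▸ hσN⟩

theorem symm_of_card_le [Finite S] (h : F.IsNormalizerConj X Y)
    (hc : Nat.card N[Y] ≤ Nat.card N[X]) : F.IsNormalizerConj Y X := by
  obtain ⟨σ, hσ, hσN⟩ := h.exists_iso_normalizer hc
  exact ⟨σ⁻¹, _, hσ.symm, hσN.symm⟩

end IsNormalizerConj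

end IsNormalizerConj

section Saturation

variable {F : FusionSystem S} {p : ℕ} {D R X Y Z : Subgroup S} {σ : Equiv.Perm S}

theorem mem_autS_iff {α : MulAut Z} :
    α ∈ autS Z ↔ ∃ g ∈ N[Z], ∀ z : Z, (α z : S) = g * z * g⁻¹ := by
  constructor
  · rintro ⟨g, rfl⟩
    exact ⟨g, g.2, fun z => rfl⟩
  · rintro ⟨g, hg, h⟩
    exact ⟨⟨g, hg⟩, MulEquiv.ext fun z => Subtype.ext (h z).symm⟩

theorem isPGroup_autS (hS : IsPGroup p S) (Z : Subgroup S) : IsPGroup p (autS Z) :=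
  (hS.to_subgroup _).of_surjective _ Z.normalizerMonoidHom.rangeRestrict_surjective

theorem autS_le_aut (F : FusionSystem S) (Z : Subgroup S) : autS Z ≤ F.Aut Z := by
  intro α hα
  obtain ⟨g, hg, h⟩ := mem_autS_iff.1 hα
  exact (Iso.conj_self_iff.2 hg).mem_aut fun z => (h z).symm

theorem mem_extControl_iff {e : X ≃* Y} (hσ : ∀ x : X, σ x = e x) {g : S} :
    g ∈ extControl e ↔ g ∈ N[X] ∧ ∃ h ∈ N[Y], ∀ x ∈ X, σ (g * x * g⁻¹) = h * σ x * h⁻¹ := by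
  have key (k : N[X]) (x : X) :
      (MulAut.congr e (X.normalizerMonoidHom k) (e x) : S) = σ (k * x * (k : S)⁻¹) := by
    have h1 : MulAut.congr e (X.normalizerMonoidHom k) (e x) = e (X.normalizerMonoidHom k x) := by
      simp only [MulAut.congr_apply, MulEquiv.trans_apply, MulEquiv.symm_apply_apply]
    rw [h1, ← hσ]
    rfl
  constructor
  · rintro ⟨k, hk, rfl⟩
    obtain ⟨h, hh, h1⟩ := mem_autS_iff.1 hk
    refine ⟨k.2, h, hh, fun x hx => ?_⟩
    rw [hσ ⟨x, hx⟩, ← h1]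
    exact (key k ⟨x, hx⟩).symm
  · rintro ⟨hg, h, hh, h1⟩
    refine ⟨⟨g, hg⟩, mem_autS_iff.2 ⟨h, hh, fun y => ?_⟩, rfl⟩
    obtain ⟨x, rfl⟩ := e.surjective y
    rw [← hσ, ← h1 x x.2]
    exact key ⟨g, hg⟩ x

theorem isReceptive_iff [Finite S] :
    F.IsReceptive Z ↔ ∀ (R : Subgroup S) (σ : Equiv.Perm S), F.Iso R Z σ → ∀ D ≤ N[R],
      (∀ d ∈ D, ∃ g ∈ N[Z], ∀ r ∈ R, σ (d * r * d⁻¹) = g * σ r * g⁻¹) →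
      ∃ (τ : Equiv.Perm S) (V W : Subgroup S), R ≤ V ∧ D ≤ V ∧ F.Iso V W τ ∧
        ∀ r ∈ R, τ r = σ r := by
  constructor
  · rintro h R σ ⟨e, he, hσ⟩ D hD hc
    obtain ⟨φ, hφ, hφe⟩ := h R e he
    obtain ⟨τ, W, -, hτ, hτφ⟩ := exists_iso_of_hom hφ
    refine ⟨τ, _, W, le_extControl e, fun d hd => (mem_extControl_iff hσ).2 ⟨hD hd, hc d hd⟩,
      hτ, fun r hr => ?_⟩
    rw [hσ ⟨r, hr⟩, ← hφe]
    exact hτφ ⟨r, le_extControl e hr⟩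
  · intro h R e he
    obtain ⟨σ, hσ, hσe⟩ := exists_iso_of_mulEquiv he
    obtain ⟨τ, V, W, hRV, hDV, ⟨f, hf, hτf⟩, hτ⟩ := h R σ hσ (extControl e)
      (fun d hd => ((mem_extControl_iff hσe).1 hd).1)
      (fun d hd => ((mem_extControl_iff hσe).1 hd).2)
    have hi : Subgroup.inclusion hDV ∈ F.Hom (extControl e) V := F.conj_mem _ 1 fun x => by simp
    have hj : Subgroup.inclusion (le_top : W ≤ ⊤) ∈ F.Hom W ⊤ := F.conj_mem _ 1 fun x => by simp
    refine ⟨_, F.comp_mem (F.comp_mem hi hf) hj, fun x => ?_⟩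
    rw [← hσe, ← hτ x x.2]
    exact (hτf ⟨x, hRV x.2⟩).symm

/-- The `F`-automorphisms of `Z` that stabilize `Y`. -/
def stabAut (F : FusionSystem S) (Z Y : Subgroup S) : Subgroup (MulAut Z) where
  carrier := {b | b ∈ F.Aut Z ∧ ∀ z : Z, (b z : S) ∈ Y ↔ (z : S) ∈ Y}
  one_mem' := ⟨one_mem _, fun z => Iff.rfl⟩
  mul_mem' := fun {a b} ha hb => ⟨mul_mem ha.1 hb.1, fun z => (ha.2 (b z)).trans (hb.2 z)⟩
  inv_mem' := fun {a} ha => ⟨inv_mem ha.1, fun z => by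
    rw [← ha.2 (a⁻¹ z), MulAut.apply_inv_self]⟩

theorem stabAut_le_aut (F : FusionSystem S) (Z Y : Subgroup S) : F.stabAut Z Y ≤ F.Aut Z :=
  fun _ hb => hb.1

theorem stabAut_self (F : FusionSystem S) (Z : Subgroup S) : F.stabAut Z Z = F.Aut Z :=
  le_antisymm (F.stabAut_le_aut Z Z) fun b hb => ⟨hb, fun z => by simp⟩

theorem Iso.exists_mem_stabAut (h : F.Iso Z Z σ) (h' : F.Iso Y Y σ) :
    ∃ b ∈ F.stabAut Z Y, ∀ z : Z, σ z = b z := by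
  obtain ⟨b, hb, hσ⟩ := h.exists_aut
  exact ⟨b, ⟨hb, fun z => by rw [← hσ, h'.mem_iff]⟩, hσ⟩

theorem iso_of_mem_stabAut (hYZ : Y ≤ Z) {b : MulAut Z} (hb : b ∈ F.stabAut Z Y) :
    F.Iso Y Y (extendAut b) := by
  have hZ : F.Iso Z Z (extendAut b) := iso_extendAut_iff.2 hb.1
  refine hZ.restrict hYZ fun s => ?_
  by_cases hs : s ∈ Z
  · rw [extendAut_apply b ⟨s, hs⟩]
    exact hb.2 ⟨s, hs⟩
  · exact iff_of_false (fun h => hs (hZ.mem_iff.1 (hYZ h))) fun h => hs (hYZ h)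

theorem map_conj_stabAut {a : MulAut Z} (ha : a ∈ F.Aut Z)
    (haY : ∀ z : Z, (a z : S) ∈ Y ↔ (z : S) ∈ X) :
    (F.stabAut Z X).map (MulAut.conj a).toMonoidHom = F.stabAut Z Y := by
  ext b
  constructor
  · rintro ⟨c, hc, rfl⟩
    refine ⟨mul_mem (mul_mem ha hc.1) (inv_mem ha), fun z => ?_⟩
    change (a (c (a⁻¹ z)) : S) ∈ Y ↔ _
    rw [haY, hc.2, ← haY, MulAut.apply_inv_self]
  · intro hb
    refine ⟨a⁻¹ * b * a, ⟨mul_mem (mul_mem (inv_mem ha) hb.1) ha, fun z => ?_⟩, ?_⟩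
    · change (a⁻¹ (b (a z)) : S) ∈ X ↔ _
      rw [← haY, MulAut.apply_inv_self, hb.2, haY]
    · simp [mul_assoc]

/-- The elements of `stabAut F Z Y` that act on `Y` as conjugation with an element of
`N_S(Z) ∩ N_S(Y)`. -/
def stabAutS (F : FusionSystem S) (Z Y : Subgroup S) : Subgroup (MulAut Z) where
  carrier := {b | b ∈ F.stabAut Z Y ∧
    ∃ g ∈ N[Z] ⊓ N[Y], ∀ z : Z, (z : S) ∈ Y → (b z : S) = g * z * g⁻¹}
  one_mem' := ⟨one_mem _, 1, one_mem _, fun z _ => by simp⟩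
  mul_mem' := by
    rintro a b ⟨ha, g, hg, hag⟩ ⟨hb, k, hk, hbk⟩
    refine ⟨mul_mem ha hb, g * k, mul_mem hg hk, fun z hz => ?_⟩
    rw [MulAut.mul_apply, hag _ ((hb.2 z).2 hz), hbk z hz]
    simp [mul_assoc]
  inv_mem' := by
    rintro a ⟨ha, g, hg, hag⟩
    refine ⟨inv_mem ha, g⁻¹, inv_mem hg, fun z hz => ?_⟩
    have h := hag (a⁻¹ z) ((inv_mem ha).2 z |>.2 hz)
    rw [MulAut.apply_inv_self] at h
    rw [h]
    simp [mul_assoc]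

theorem mem_normalizer_of_stabilizes (hYZ : Y ≤ Z) {g : S} (hg : g ∈ N[Z])
    (h : ∀ z ∈ Z, g * z * g⁻¹ ∈ Y ↔ z ∈ Y) : g ∈ N[Y] := by
  refine Subgroup.mem_normalizer_iff.2 fun s => ?_
  by_cases hs : s ∈ Z
  · exact (h s hs).symm
  · refine iff_of_false (fun h => hs (hYZ h)) fun h => hs ?_
    exact (Subgroup.mem_normalizer_iff.1 hg s).2 (hYZ h)

theorem autS_inf_stabAut_le (hYZ : Y ≤ Z) : autS Z ⊓ F.stabAut Z Y ≤ F.stabAutS Z Y := by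
  rintro b ⟨hb, hbY⟩
  obtain ⟨g, hg, hbg⟩ := mem_autS_iff.1 hb
  have hgY : g ∈ N[Y] := mem_normalizer_of_stabilizes hYZ hg fun z hz => by
    rw [← hbg ⟨z, hz⟩]
    exact hbY.2 ⟨z, hz⟩
  exact ⟨hbY, g, ⟨hg, hgY⟩, fun z _ => hbg z⟩

/-- Some `F`-conjugate of `X` is fully automized and receptive. -/
def IsSaturatedAt (p : ℕ) (F : FusionSystem S) (X : Subgroup S) : Prop :=
  ∃ Q : Subgroup S, F.IsConj X Q ∧ F.IsFullyAutomized p Q ∧ F.IsReceptive Q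

/-- Saturation relative to a subgroup `Y ≤ Z`: the subgroup `Z` is receptive, and the part of
`Aut_S(Z)` stabilizing `Y` is a Sylow `p`-subgroup of the stabilizer of `Y` in `Aut_F(Z)`. -/
structure IsSaturatedPair (p : ℕ) (F : FusionSystem S) (Z Y : Subgroup S) : Prop where
  le : Y ≤ Z
  isReceptive : F.IsReceptive Z
  isSylowIn : IsSylowIn p (autS Z ⊓ F.stabAut Z Y) (F.stabAut Z Y)

theorem isSaturatedPair_self (haut : F.IsFullyAutomized p Z) (hrec : F.IsReceptive Z) :
    F.IsSaturatedPair p Z Z := by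
  refine ⟨le_rfl, hrec, ?_⟩
  rw [stabAut_self, inf_eq_left.2 (F.autS_le_aut Z)]
  exact haut

theorem Iso.exists_mem_stabAut_of_mem_normalizer (hR : F.Iso R Z σ) (hX : F.Iso X Y σ) {d : S}
    (hd : d ∈ N[R] ⊓ N[X]) :
    ∃ b ∈ F.stabAut Z Y, ∀ r ∈ R, extendAut b (σ r) = σ (d * r * d⁻¹) := by
  obtain ⟨b, hb, hσb⟩ := ((hR.symm.trans (conj_self_iff.2 hd.1)).trans hR).exists_mem_stabAut
    ((hX.symm.trans (conj_self_iff.2 hd.2)).trans hX)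
  refine ⟨b, hb, fun r hr => ?_⟩
  rw [extendAut_apply b ⟨σ r, hR.mem_iff.2 hr⟩, ← hσb]
  simp

variable [Finite S] [Fact p.Prime]

theorem IsReceptive.exists_extend (hS : IsPGroup p S) (hZ : F.IsReceptive Z)
    {B : Subgroup (MulAut Z)} (hBF : B ≤ F.Aut Z) (hB : IsSylowIn p (autS Z ⊓ B) B)
    (hR : F.Iso R Z σ) (hDN : D ≤ N[R])
    (hD : ∀ d ∈ D, ∃ b ∈ B, ∀ r ∈ R, extendAut b (σ r) = σ (d * r * d⁻¹)) :
    ∃ b ∈ B, ∃ (τ : Equiv.Perm S) (V W : Subgroup S), R ≤ V ∧ D ≤ V ∧ F.Iso V W τ ∧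
      ∀ r ∈ R, τ r = extendAut b (σ r) := by
  obtain ⟨e, _, hσ⟩ := id hR
  let f : N[R] →* MulAut Z := (MulAut.congr e).toMonoidHom.comp R.normalizerMonoidHom
  have hf (d : N[R]) (r : R) : (f d (e r) : S) = σ (d * r * (d : S)⁻¹) := by
    have h : f d (e r) = e (R.normalizerMonoidHom d r) := by simp [f, MulAut.congr]
    rw [h, ← hσ]
    rfl
  have hDB : (D.subgroupOf N[R]).map f ≤ B := by
    rintro _ ⟨d, hd, rfl⟩
    obtain ⟨b, hb, hbd⟩ := hD d hd
    convert hb using 1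
    refine MulEquiv.ext fun z => Subtype.ext ?_
    obtain ⟨r, rfl⟩ := e.surjective z
    rw [hf, ← hbd r r.2, hσ, extendAut_apply]
  obtain ⟨b, hb, hconj⟩ := hB.exists_conj hDB ((isPGroup_subgroupOf (hS.to_subgroup D) _).map f)
  have hiso : F.Iso R Z (extendAut b * σ) := hR.trans (iso_extendAut_iff.2 (hBF hb))
  obtain ⟨τ, V, W, hRV, hDV, hτ, hτσ⟩ := isReceptive_iff.1 hZ R _ hiso D hDN fun d hd => by
    obtain ⟨g, hg, hgf⟩ := mem_autS_iff.1 (hconj ⟨_, ⟨⟨d, hDN hd⟩, hd, rfl⟩, rfl⟩).1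
    refine ⟨g, hg, fun r hr => ?_⟩
    have hgr : (b (f ⟨d, hDN hd⟩ (b⁻¹ (b (e ⟨r, hr⟩)))) : S) = g * b (e ⟨r, hr⟩) * g⁻¹ := hgf _
    rw [MulAut.inv_apply_self] at hgr
    rw [Equiv.Perm.mul_apply, Equiv.Perm.mul_apply, hσ ⟨r, hr⟩, extendAut_apply, ← hgr,
      ← extendAut_apply, hf]
  exact ⟨b, hb, τ, V, W, hRV, hDV, hτ, hτσ⟩

theorem IsSaturatedPair.exists_extend (hS : IsPGroup p S) (h : F.IsSaturatedPair p Z Y)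
    (hR : F.Iso R Z σ) (hX : F.Iso X Y σ) :
    ∃ τ V W, F.Iso R Z τ ∧ F.Iso X Y τ ∧ R ≤ V ∧ N[R] ⊓ N[X] ≤ V ∧ F.Iso V W τ := by
  have hXR : X ≤ R := hX.symm.le_of_le hR.symm h.le
  obtain ⟨b, hb, τ, V, W, hRV, hNV, hτ, hτσ⟩ := h.isReceptive.exists_extend hS
    (F.stabAut_le_aut Z Y) h.isSylowIn hR inf_le_left
    fun d hd => hR.exists_mem_stabAut_of_mem_normalizer hX hd
  exact ⟨τ, V, W, (hR.trans (iso_extendAut_iff.2 hb.1)).congr hτσ,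
    (hX.trans (iso_of_mem_stabAut h.le hb)).congr fun x hx => hτσ x (hXR hx), hRV, hNV, hτ⟩

theorem IsSaturatedPair.exists_extend_eqOn (hS : IsPGroup p S) (h : F.IsSaturatedPair p Z Y)
    (hR : F.Iso R Z σ) (hX : F.Iso X Y σ) (hDN : D ≤ N[R] ⊓ N[X])
    (hD : ∀ d ∈ D, ∃ g ∈ N[Z] ⊓ N[Y], ∀ x ∈ X, σ (d * x * d⁻¹) = g * σ x * g⁻¹) :
    ∃ τ V W, F.Iso R Z τ ∧ (∀ x ∈ X, τ x = σ x) ∧ R ≤ V ∧ D ≤ V ∧ F.Iso V W τ := by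
  have hXR : X ≤ R := hX.symm.le_of_le hR.symm h.le
  have hB : F.stabAutS Z Y ≤ F.stabAut Z Y := fun b hb => hb.1
  have hsyl : IsSylowIn p (autS Z ⊓ F.stabAutS Z Y) (F.stabAutS Z Y) := by
    have heq : autS Z ⊓ F.stabAutS Z Y = autS Z ⊓ F.stabAut Z Y :=
      le_antisymm (inf_le_inf_left _ hB) (le_inf inf_le_left (autS_inf_stabAut_le h.le))
    exact heq ▸ h.isSylowIn.mono (autS_inf_stabAut_le h.le) hB
  have hDB : ∀ d ∈ D, ∃ b ∈ F.stabAutS Z Y, ∀ r ∈ R, extendAut b (σ r) = σ (d * r * d⁻¹) := by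
    intro d hd
    obtain ⟨b, hb, hbd⟩ := hR.exists_mem_stabAut_of_mem_normalizer hX (hDN hd)
    obtain ⟨g, hg, hgd⟩ := hD d hd
    refine ⟨b, ⟨hb, g, hg, fun z hz => ?_⟩, hbd⟩
    obtain ⟨x, hx, hxz⟩ := hX.exists_apply_eq hz
    rw [← extendAut_apply, ← hxz, hbd x (hXR hx), hgd x hx]
  obtain ⟨b, ⟨hb, g, hg, hbg⟩, τ, V, W, hRV, hDV, hτ, hτσ⟩ := h.isReceptive.exists_extend hS
    (hB.trans (F.stabAut_le_aut Z Y)) hsyl hR (hDN.trans inf_le_left) hDB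
  -- `τ` agrees with conjugation by `g` after `σ` on `X`, so the conjugation has to be undone.
  obtain ⟨W', -, hW'⟩ : ∃ W' ≤ ⊤, F.Iso W W' c[g⁻¹] :=
    (Iso.conj F (X := ⊤) (Y := ⊤) g⁻¹ (by simp)).exists_restrict le_top
  refine ⟨c[g⁻¹] * τ, V, W', ?_, fun x hx => ?_, hRV, hDV, hτ.trans hW'⟩
  · exact ((hR.trans (iso_extendAut_iff.2 hb.1)).congr hτσ).trans
      (Iso.conj_self_iff.2 (inv_mem hg.1))
  · have hxY : σ x ∈ Y := hX.mem_iff.2 hx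
    rw [Equiv.Perm.mul_apply, hτσ x (hXR hx), extendAut_apply b ⟨σ x, h.le hxY⟩, hbg _ hxY]
    simp [mul_assoc]

theorem IsSaturatedAt.exists_isSaturatedPair (hS : IsPGroup p S) (hR : F.IsSaturatedAt p R)
    (hXR : X ≤ R) : ∃ Z Y σ V W, F.IsSaturatedPair p Z Y ∧ F.Iso R Z σ ∧ F.Iso X Y σ ∧ R ≤ V ∧
      N[R] ⊓ N[X] ≤ V ∧ F.Iso V W σ := by
  obtain ⟨Z, hconj, haut, hrec⟩ := hR
  obtain ⟨σ, hσ⟩ := hconj.exists_iso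
  obtain ⟨Y₀, hY₀, hσX⟩ := hσ.exists_restrict hXR
  obtain ⟨a, ha, hsyl⟩ := IsSylowIn.exists_conj_inf (B := F.Aut Z) haut (F.stabAut_le_aut Z Y₀)
  have haZ : F.Iso Z Z (extendAut a) := iso_extendAut_iff.2 ha
  obtain ⟨Y, hY, haY⟩ := haZ.exists_restrict hY₀
  rw [map_conj_stabAut ha fun z => by rw [← extendAut_apply, haY.mem_iff]] at hsyl
  have hpair : F.IsSaturatedPair p Z Y := ⟨hY, hrec, hsyl⟩
  obtain ⟨τ, V, W, hτ⟩ := hpair.exists_extend hS (hσ.trans haZ) (hσX.trans haY)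
  exact ⟨Z, Y, τ, V, W, hpair, hτ⟩

theorem IsConj.isNormalizerConj (hS : IsPGroup p S) (h : F.IsConj X Y)
    (haut : F.IsFullyAutomized p Y) (hrec : F.IsReceptive Y) : F.IsNormalizerConj X Y := by
  obtain ⟨σ, hσ⟩ := h.exists_iso
  obtain ⟨τ, V, W, hτ, -, -, hNV, hV⟩ := (isSaturatedPair_self haut hrec).exists_extend hS hσ hσ
  exact hτ.isNormalizerConj hV ((inf_idem N[X]).ge.trans hNV)

end Saturation

section Generate

variable {F : FusionSystem S} {A : Set (Σ Q : Subgroup S, MulAut Q)} {X X' Y : Subgroup S}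
  {σ : Equiv.Perm S} {Pr : Subgroup S → Subgroup S → Equiv.Perm S → Prop}

/-- A property of isomorphisms between subgroups of `S`, encoded by permutations as in `Iso`, that
only depends on the values on the source and is closed under composition and inversion. -/
structure IsGroupoidal (Pr : Subgroup S → Subgroup S → Equiv.Perm S → Prop) : Prop where
  congr : ∀ {X Y : Subgroup S} {σ τ : Equiv.Perm S},
    Pr X Y σ → (∀ x ∈ X, τ x = σ x) → Pr X Y τ
  trans : ∀ {X Y Z : Subgroup S} {σ τ : Equiv.Perm S}, Pr X Y σ → Pr Y Z τ → Pr X Z (τ * σ)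
  symm : ∀ {X Y : Subgroup S} {σ : Equiv.Perm S}, Pr X Y σ → Pr Y X σ⁻¹

theorem IsGroupoidal.iso_and_isConj_imp {X₀ : Subgroup S} (hPr : IsGroupoidal Pr) :
    IsGroupoidal fun X Y σ => F.Iso X Y σ ∧ (F.IsConj X₀ X → Pr X Y σ) where
  congr h hτ := ⟨h.1.congr hτ, fun hX => hPr.congr (h.2 hX) hτ⟩
  trans h h' := ⟨h.1.trans h'.1, fun hX => hPr.trans (h.2 hX) (h'.2 (hX.trans h.1.isConj))⟩
  symm h := ⟨h.1.symm, fun hY => hPr.symm (h.2 (hY.trans h.1.isConj.symm))⟩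

theorem apply_mem_map_subgroupOf_iff {φ : X →* Y} (h : ∀ x : X, σ x = φ x) (hX : X' ≤ X) {s : S} :
    σ s ∈ (X'.subgroupOf X).map (Y.subtype.comp φ) ↔ s ∈ X' := by
  constructor
  · rintro ⟨x, hx, hxs⟩
    exact σ.injective ((h x).trans hxs) ▸ hx
  · exact fun hs => ⟨⟨s, hX hs⟩, hs, (h ⟨s, hX hs⟩).symm⟩

/-- The fusion system of all injective homomorphisms `X → Y` that are the restriction of a
permutation all of whose restrictions to subgroups of `X` have the groupoidal property `Pr`. -/
def ofGroupoidal (hPr : IsGroupoidal Pr)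
    (hconj : ∀ (g : S) (X Y : Subgroup S), (∀ s, g * s * g⁻¹ ∈ Y ↔ s ∈ X) → Pr X Y c[g]) :
    FusionSystem S where
  Hom X Y := {φ | Function.Injective φ ∧ ∃ σ : Equiv.Perm S, (∀ x : X, σ x = φ x) ∧
    ∀ X' ≤ X, ∀ Y', (∀ s, σ s ∈ Y' ↔ s ∈ X') → Pr X' Y' σ}
  injective h := h.1
  comp_mem {X Y Z φ ψ} := by
    rintro ⟨hφ, σ, hσ, hσP⟩ ⟨hψ, τ, hτ, hτP⟩
    refine ⟨hψ.comp hφ, τ * σ, fun x => ?_, fun X' hX' Z' hZ' => ?_⟩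
    · rw [Equiv.Perm.mul_apply, hσ, hτ]
      rfl
    · refine hPr.trans (hσP X' hX' _ fun s => apply_mem_map_subgroupOf_iff hσ hX')
        (hτP _ ?_ Z' fun s => ?_)
      · rintro _ ⟨x, -, rfl⟩
        exact (φ x).2
      · rw [← σ.apply_symm_apply s, apply_mem_map_subgroupOf_iff hσ hX', ← hZ']
        rfl
  conj_mem {X Y} φ g h := by
    have hφ : ∀ x : X, c[g⁻¹] x = φ x := fun x => by simp [h]
    refine ⟨fun x y hxy => Subtype.ext ((MulAut.conj g⁻¹).injective ?_), _, hφ,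
      fun X' _ Y' hY' => hconj g⁻¹ X' Y' hY'⟩
    exact (hφ x).trans ((congrArg Subtype.val hxy).trans (hφ y).symm)
  factor {X Y φ} := by
    rintro ⟨hφ, σ, hσ, hσP⟩
    have hφ' : Function.Injective (Y.subtype.comp φ) := Y.subtype_injective.comp hφ
    have hR : (Y.subtype.comp φ).range ≤ Y := by
      rintro _ ⟨x, rfl⟩
      exact (φ x).2
    refine ⟨_, hR, MonoidHom.ofInjective hφ',
      ⟨(MonoidHom.ofInjective hφ').injective, σ, hσ, hσP⟩,
      ⟨(MonoidHom.ofInjective hφ').symm.injective, σ⁻¹, fun y => ?_, fun X' hX' Y' hY' => ?_⟩, ?_⟩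
    · obtain ⟨x, rfl⟩ := (MonoidHom.ofInjective hφ').surjective y
      rw [Equiv.Perm.inv_eq_iff_eq, MulEquiv.coe_toMonoidHom, MulEquiv.symm_apply_apply, hσ]
      rfl
    · refine hPr.symm (hσP Y' (fun s hs => ?_) X' fun s => by simp [← hY'])
      obtain ⟨x, hx⟩ := hX' (show σ s ∈ X' by simpa [← hY'] using hs)
      exact σ.injective ((hσ x).trans hx) ▸ x.2
    · ext x
      rfl

theorem generate_induction (hPr : IsGroupoidal Pr)
    (hconj : ∀ (g : S) (X Y : Subgroup S), (∀ s, g * s * g⁻¹ ∈ Y ↔ s ∈ X) → Pr X Y c[g])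
    (hbase : ∀ (E : Subgroup S) (α : MulAut E), ⟨E, α⟩ ∈ A → ∀ X ≤ E, ∀ Y,
      (∀ s, extendAut α s ∈ Y ↔ s ∈ X) → Pr X Y (extendAut α))
    (h : (generate A).Iso X Y σ) : Pr X Y σ := by
  obtain ⟨e, ⟨-, he⟩, hσ⟩ := h
  obtain ⟨-, τ, hτ, hτP⟩ := he (ofGroupoidal hPr hconj) (by
    rintro ⟨E, α⟩ hα
    exact ⟨α.injective, extendAut α, extendAut_apply α, hbase E α hα⟩)
  replace hτ : ∀ x : X, τ x = e x := hτ
  refine hPr.congr (hτP X le_rfl Y fun s => ⟨fun hs => ?_, fun hs => ?_⟩) fun x hx => ?_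
  · obtain ⟨x, hx⟩ := e.surjective ⟨_, hs⟩
    exact τ.injective ((hτ x).trans (congrArg Subtype.val hx)) ▸ x.2
  · exact hτ ⟨s, hs⟩ ▸ (e _).2
  · rw [hσ ⟨x, hx⟩, hτ ⟨x, hx⟩]

theorem mem_aut_generate {E : Subgroup S} {α : MulAut E} (h : ⟨E, α⟩ ∈ A) :
    α ∈ (generate A).Aut E :=
  ⟨α.injective, fun _ hG => hG _ h⟩

theorem generate_le (hA : ∀ x ∈ A, x.2 ∈ F.Aut x.1) : generate A ≤ F :=
  fun _ _ _ hφ => hφ.2 F hA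

end Generate

section ExtAut

variable {F G : FusionSystem S} {P Q V W : Subgroup S} {ρ : Equiv.Perm S} {α : MulAut Q}

theorem mem_extAut_of_iso (hα : α ∈ F.Aut Q) (hρ : F.Iso V W ρ) (hV : Q < V)
    (h : ∀ x : Q, ρ x = α x) : α ∈ F.extAut Q := by
  have hW : Q < W := (iso_of_mem_aut hα h).lt_of_lt hρ hV
  obtain ⟨e, he, h1⟩ := hρ
  refine Subgroup.subset_closure ⟨hα, V, W, hV, hW, e, he, fun x => ?_⟩
  rw [← h]
  exact (h1 ⟨x, hV.le x.2⟩).symm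

theorem extAut_le_aut (F : FusionSystem S) (Q : Subgroup S) : F.extAut Q ≤ F.Aut Q := by
  rw [extAut, Subgroup.closure_le]
  exact fun α h => h.1

theorem extAut_le_iff [Finite S] {K : Subgroup (MulAut Q)} :
    F.extAut Q ≤ K ↔ ∀ α V W ρ, Q < V → F.Iso V W ρ → F.Iso Q Q ρ → (∀ x : Q, ρ x = α x) →
      α ∈ K := by
  refine ⟨fun hK α V W ρ hV hρ hρQ hα => hK (mem_extAut_of_iso (hρQ.mem_aut hα) hρ hV hα),
    fun h => (Subgroup.closure_le K).2 ?_⟩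
  rintro α ⟨hα, V, W, hV, -, e, he, hαe⟩
  obtain ⟨ρ, hρ, hρe⟩ := exists_iso_of_mulEquiv he
  have hρα (x : Q) : ρ x = α x := (hρe ⟨x, hV.le x.2⟩).trans (hαe x)
  exact h α V W ρ hV hρ (iso_of_mem_aut hα hρα) hρα

theorem aut_mono (hGF : G ≤ F) (Q : Subgroup S) : G.Aut Q ≤ F.Aut Q :=
  fun _ hα => hGF Q Q hα

end ExtAut

section Transports

variable {F : FusionSystem S} {Q : Subgroup S} {K : Subgroup (MulAut Q)} {X Y Z : Subgroup S}
  {σ τ : Equiv.Perm S}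

/-- Every `F`-conjugate of `Q` is mapped to `Q` by a morphism of `F` defined on its normalizer. -/
def IsNormalizerTerminal (F : FusionSystem S) (Q : Subgroup S) : Prop :=
  ∀ X, F.IsConj X Q → F.IsNormalizerConj X Q

/-- `σ : X → Y` becomes an element of `K ≤ Aut(Q)` when `X` and `Y` are moved to `Q` along any
morphisms defined on their normalizers. -/
def Transports (F : FusionSystem S) {Q : Subgroup S} (K : Subgroup (MulAut Q))
    (X Y : Subgroup S) (σ : Equiv.Perm S) : Prop :=
  F.Iso X Y σ ∧ ∀ (χ χ' : Equiv.Perm S) (W W' : Subgroup S), F.Iso X Q χ → F.Iso N[X] W χ →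
    F.Iso Y Q χ' → F.Iso N[Y] W' χ' → ∃ α ∈ K, ∀ x ∈ X, χ' (σ x) = extendAut α (χ x)

namespace Transports

theorem congr (h : F.Transports K X Y σ) (hτ : ∀ x ∈ X, τ x = σ x) : F.Transports K X Y τ := by
  refine ⟨h.1.congr hτ, fun χ χ' W W' hχ hχN hχ' hχN' => ?_⟩
  obtain ⟨α, hα, hασ⟩ := h.2 χ χ' W W' hχ hχN hχ' hχN'
  exact ⟨α, hα, fun x hx => by rw [hτ x hx, hασ x hx]⟩

theorem symm (h : F.Transports K X Y σ) : F.Transports K Y X σ⁻¹ := by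
  refine ⟨h.1.symm, fun χ χ' W W' hχ hχN hχ' hχN' => ?_⟩
  obtain ⟨α, hα, hασ⟩ := h.2 χ' χ W' W hχ' hχN' hχ hχN
  refine ⟨α⁻¹, inv_mem hα, fun y hy => ?_⟩
  have hx : σ⁻¹ y ∈ X := h.1.inv_mem_iff.2 hy
  have hy' := hασ _ hx
  rw [Equiv.Perm.coe_inv, Equiv.apply_symm_apply,
    extendAut_apply α ⟨χ' (σ.symm y), hχ'.mem_iff.2 hx⟩] at hy'
  rw [hy', extendAut_apply, MulAut.inv_apply_self, Equiv.Perm.coe_inv]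

theorem trans (hQ : F.IsNormalizerTerminal Q) (h : F.Transports K X Y σ)
    (h' : F.Transports K Y Z τ) : F.Transports K X Z (τ * σ) := by
  refine ⟨h.1.trans h'.1, fun χ χ' W W' hχ hχN hχ' hχN' => ?_⟩
  obtain ⟨ξ, V, hξ, hξN⟩ := hQ Y (h.1.isConj.symm.trans hχ.isConj)
  obtain ⟨α, hα, hασ⟩ := h.2 χ ξ W V hχ hχN hξ hξN
  obtain ⟨β, hβ, hβτ⟩ := h'.2 ξ χ' V W' hξ hξN hχ' hχN'
  refine ⟨β * α, mul_mem hβ hα, fun x hx => ?_⟩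
  have hxQ : χ x ∈ Q := hχ.mem_iff.2 hx
  rw [Equiv.Perm.mul_apply, hβτ _ (h.1.mem_iff.2 hx), hασ x hx, extendAut_apply α ⟨_, hxQ⟩,
    extendAut_apply, extendAut_apply (β * α) ⟨_, hxQ⟩, MulAut.mul_apply]

theorem exists_mem (h : F.Transports K Q Q σ) : ∃ α ∈ K, ∀ x : Q, σ x = α x := by
  obtain ⟨α, hα, hασ⟩ := h.2 1 1 _ _ (Iso.refl F Q) (Iso.refl F _) (Iso.refl F Q) (Iso.refl F _)
  exact ⟨α, hα, fun x => by simpa [extendAut_apply] using hασ x x.2⟩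

theorem of_mem (hQ : Q < N[Q]) (hK : F.extAut Q ≤ K) (hKF : K ≤ F.Aut Q) {α : MulAut Q}
    (hα : α ∈ K) : F.Transports K Q Q (extendAut α) := by
  refine ⟨iso_extendAut_iff.2 (hKF hα), fun χ χ' W W' hχ hχN hχ' hχN' => ?_⟩
  obtain ⟨β, hβ, hβχ⟩ := hχ.exists_aut
  obtain ⟨γ, hγ, hγχ⟩ := hχ'.exists_aut
  have hβK := hK (mem_extAut_of_iso hβ hχN hQ hβχ)
  have hγK := hK (mem_extAut_of_iso hγ hχN' hQ hγχ)
  refine ⟨γ * α * β⁻¹, mul_mem (mul_mem hγK hα) (inv_mem hβK), fun x hx => ?_⟩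
  rw [extendAut_apply α ⟨x, hx⟩, hγχ, hβχ ⟨x, hx⟩, extendAut_apply]
  simp

end Transports

theorem isGroupoidal_transports (hQ : F.IsNormalizerTerminal Q) :
    IsGroupoidal (F.Transports K) where
  congr := Transports.congr
  trans := Transports.trans hQ
  symm := Transports.symm

theorem Transports.of_extends [Finite S] {p : ℕ} [Fact p.Prime] (hS : IsPGroup p S)
    (hK : F.extAut Q ≤ K) {R R' : Subgroup S} (h : F.Iso X Y σ) (hXR : X < R)
    (hR : F.Iso R R' σ) : F.Transports K X Y σ := by
  refine ⟨h, fun χ χ' W W' hχ hχN hχ' hχN' => ?_⟩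
  have hlt := lt_inf_normalizer (hS.to_subgroup R) hXR
  obtain ⟨V₁, -, hχR⟩ := hχN.exists_restrict (X := R ⊓ N[X]) inf_le_right
  obtain ⟨V₂, -, hσR⟩ := hR.exists_restrict (X := R ⊓ N[X]) inf_le_left
  obtain ⟨V₃, -, hχR'⟩ := hχN'.exists_restrict (hσR.le_normalizer h hlt.le inf_le_right)
  obtain ⟨α, hα, hαe⟩ := ((hχ.symm.trans h).trans hχ').exists_aut
  refine ⟨α, hK (mem_extAut_of_iso hα ((hχR.symm.trans hσR).trans hχR') (hχ.lt_of_lt hχR hlt) hαe),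
    fun x hx => ?_⟩
  rw [extendAut_apply α ⟨χ x, hχ.mem_iff.2 hx⟩, ← hαe]
  simp

end Transports

section IsGeneratedAbove

variable {F : FusionSystem S} {p : ℕ} {X₀ X Y Z : Subgroup S} {σ : Equiv.Perm S}

/-- The subgroups `X` and `Y` can be mapped to one subgroup of `S` by morphisms of `F` that are
defined on their normalizers. -/
def IsNormalizerJoinable (F : FusionSystem S) (X Y : Subgroup S) : Prop :=
  ∃ Q, F.IsNormalizerConj X Q ∧ F.IsNormalizerConj Y Q

theorem IsNormalizerJoinable.symm (h : F.IsNormalizerJoinable X Y) :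
    F.IsNormalizerJoinable Y X := by
  obtain ⟨Q, hX, hY⟩ := h
  exact ⟨Q, hY, hX⟩

theorem IsNormalizerJoinable.trans (hY : Y < N[Y])
    (hjoin : ∀ X' Z' R R' σ, F.IsConj Y X' → X' < R → R ≤ N[X'] → Nat.card N[Y] ≤ Nat.card R →
      F.Iso X' Z' σ → F.Iso R R' σ → F.IsNormalizerJoinable X' Z')
    (h : F.IsNormalizerJoinable X Y) (h' : F.IsNormalizerJoinable Y Z) :
    F.IsNormalizerJoinable X Z := by
  obtain ⟨Q, hXQ, θ, W, hθ, hθN⟩ := h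
  obtain ⟨Q', ⟨θ', W', hθ', hθN'⟩, hZQ'⟩ := h'
  obtain ⟨Q'', hQ, hQ'⟩ := hjoin Q Q' W W' (θ' * θ⁻¹) hθ.isConj (hθ.lt_of_lt hθN hY)
    (hθN.le_normalizer hθ Subgroup.le_normalizer le_rfl) hθN.card_eq.le (hθ.symm.trans hθ')
    (hθN.symm.trans hθN')
  exact ⟨Q'', hXQ.trans hQ, hZQ'.trans hQ'⟩

/-- The isomorphisms of `F` between conjugates of `X₀` are generated by those that extend to
strictly larger subgroups. -/
def IsGeneratedAbove (F : FusionSystem S) (X₀ : Subgroup S) : Prop :=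
  ∀ Pr : Subgroup S → Subgroup S → Equiv.Perm S → Prop, IsGroupoidal Pr →
    (∀ X Y R R' σ, F.IsConj X₀ X → X < R → F.Iso X Y σ → F.Iso R R' σ → Pr X Y σ) →
    ∀ X Y σ, F.IsConj X₀ X → F.Iso X Y σ → Pr X Y σ

theorem lt_of_le_of_card_lt (h : X ≤ Y) (hc : Nat.card X < Nat.card Y) : X < Y :=
  lt_of_le_of_ne h (by rintro rfl; exact hc.false)

@[elab_as_elim]
theorem induction_card_gt [Finite S] {motive : Subgroup S → Prop}
    (step : ∀ R : Subgroup S,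
      (∀ R' : Subgroup S, Nat.card R < Nat.card R' → motive R') → motive R)
    (R : Subgroup S) : motive R :=
  step R fun R' _ => induction_card_gt step R'
termination_by Nat.card S - Nat.card R
decreasing_by
  have := Subgroup.card_le_card_group R'
  omega

variable [Finite S]

theorem card_lt_card_of_lt (h : X < Y) : Nat.card X < Nat.card Y :=
  Set.Finite.card_lt_card (Set.toFinite _) h

theorem exists_isConj_forall_card_normalizer_le (F : FusionSystem S) (X₀ : Subgroup S) :
    ∃ Q, F.IsConj X₀ Q ∧ ∀ X, F.IsConj X₀ X → Nat.card N[X] ≤ Nat.card N[Q] :=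
  Set.exists_max_image {X : Subgroup S | F.IsConj X₀ X} (fun X => Nat.card N[X]) (Set.toFinite _)
    ⟨X₀, IsConj.refl F X₀⟩

variable [Fact p.Prime]

theorem lt_normalizer (hS : IsPGroup p S) (hX : X < ⊤) : X < N[X] := by
  have := hS.isNilpotent
  exact Group.normalizerCondition_of_isNilpotent X hX

theorem isNormalizerJoinable_of_iso (hS : IsPGroup p S)
    (hsat : ∀ R : Subgroup S, Nat.card X₀ < Nat.card R → F.IsSaturatedAt p R) (R : Subgroup S) :
    ∀ X Y R' σ, F.IsConj X₀ X → X < R → R ≤ N[X] → F.Iso X Y σ → F.Iso R R' σ →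
      F.IsNormalizerJoinable X Y := by
  induction R using induction_card_gt with | step R ih
  intro X Y R' σ hX hXR hRN h hR
  by_cases hNR : N[X] ≤ R
  · exact ⟨Y, h.isNormalizerConj hR hNR, .refl F Y⟩
  have hRN' : R' ≤ N[Y] := hR.le_normalizer h hXR.le hRN
  by_cases hNR' : N[Y] ≤ R'
  · exact ⟨X, .refl F X, h.symm.isNormalizerConj hR.symm hNR'⟩
  obtain ⟨Z, Q, χ, V, W, hpair, hχR, hχ, -, hV, hχV⟩ := (hsat R
    (hX.card_eq.trans_lt (card_lt_card_of_lt hXR))).exists_isSaturatedPair hS hXR.le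
  obtain ⟨R₁, -, hR₁⟩ := hχV.exists_restrict hV
  have hlt : R < N[R] ⊓ N[X] := by
    simpa only [inf_comm] using
      lt_inf_normalizer (hS.to_subgroup _) (lt_of_le_not_ge hRN hNR)
  have hXQ : F.IsNormalizerJoinable X Q :=
    ih _ (card_lt_card_of_lt hlt) X Q R₁ χ hX (hXR.trans hlt) inf_le_right hχ hR₁
  obtain ⟨τ, V', W', -, hτ, -, hV', hτV⟩ :=
    hpair.exists_extend hS (hR.symm.trans hχR) (h.symm.trans hχ)
  obtain ⟨R₂, -, hR₂⟩ := hτV.exists_restrict hV'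
  have hlt' : R' < N[R'] ⊓ N[Y] := by
    simpa only [inf_comm] using
      lt_inf_normalizer (hS.to_subgroup _) (lt_of_le_not_ge hRN' hNR')
  have hYQ : F.IsNormalizerJoinable Y Q :=
    ih _ (hR.card_eq.trans_lt (card_lt_card_of_lt hlt')) Y Q R₂ τ (hX.trans h.isConj)
      ((h.lt_of_lt hR hXR).trans hlt') inf_le_right hτ hR₂
  have hR₁N : R₁ ≤ N[Q] := hR₁.le_normalizer hχ (hXR.trans hlt).le inf_le_right
  have hRQ : Nat.card R < Nat.card N[Q] := (card_lt_card_of_lt hlt).trans_le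
    (hR₁.card_eq.trans_le (Subgroup.card_le_of_le hR₁N))
  refine hXQ.trans ((hχ.lt_of_lt hR₁ (hXR.trans hlt)).trans_le hR₁N) ?_ hYQ.symm
  exact fun X' Z' U U' ρ hX' hU hUN hc hρ hρU =>
    ih U (hRQ.trans_le hc) X' Z' U' ρ ((hX.trans hχ.isConj).trans hX') hU hUN hρ hρU

theorem IsGeneratedAbove.isNormalizerJoinable (hgen : F.IsGeneratedAbove X₀) (hS : IsPGroup p S)
    (hX₀ : X₀ < ⊤) (hsat : ∀ R : Subgroup S, Nat.card X₀ < Nat.card R → F.IsSaturatedAt p R)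
    (hX : F.IsConj X₀ X) (h : F.Iso X Y σ) : F.IsNormalizerJoinable X Y := by
  have hlt (X) (hX : F.IsConj X₀ X) : X < N[X] := lt_normalizer hS
    (lt_of_le_of_card_lt le_top (hX.card_eq.symm.trans_lt (card_lt_card_of_lt hX₀)))
  let Pr (X Y : Subgroup S) (_ : Equiv.Perm S) : Prop :=
    F.IsConj X₀ X ∧ F.IsConj X₀ Y ∧ F.IsNormalizerJoinable X Y
  have hPr : IsGroupoidal Pr :=
    { congr := fun h _ => h
      trans := fun {X Y Z} _ _ ⟨hX, hY, h⟩ ⟨_, hZ, h'⟩ =>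
        ⟨hX, hZ, h.trans (hlt Y hY) (fun X' Z' R R' σ hX' hR hRN _ =>
          isNormalizerJoinable_of_iso hS hsat R X' Z' R' σ (hY.trans hX') hR hRN) h'⟩
      symm := fun ⟨hX, hY, h⟩ => ⟨hY, hX, h.symm⟩ }
  refine (hgen Pr hPr (fun X Y R R' σ hX hXR h hR => ?_) X Y σ hX h).2.2
  obtain ⟨V, -, hV⟩ := hR.exists_restrict (inf_le_left : R ⊓ N[X] ≤ R)
  exact ⟨hX, hX.trans h.isConj, isNormalizerJoinable_of_iso hS hsat (R ⊓ N[X]) X Y V σ hX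
    (lt_inf_normalizer (hS.to_subgroup R) hXR) inf_le_right h hV⟩

theorem IsGeneratedAbove.exists_isNormalizerTerminal (hgen : F.IsGeneratedAbove X₀)
    (hS : IsPGroup p S) (hX₀ : X₀ < ⊤)
    (hsat : ∀ R : Subgroup S, Nat.card X₀ < Nat.card R → F.IsSaturatedAt p R) :
    ∃ Q, F.IsConj X₀ Q ∧ F.IsNormalizerTerminal Q := by
  obtain ⟨Q, hQ, hmax⟩ := F.exists_isConj_forall_card_normalizer_le X₀
  refine ⟨Q, hQ, fun X hXQ => ?_⟩
  obtain ⟨σ, hσ⟩ := hXQ.exists_iso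
  have hX : F.IsConj X₀ X := hQ.trans hXQ.symm
  obtain ⟨Y, hXY, hQY⟩ := hgen.isNormalizerJoinable hS hX₀ hsat hX hσ
  exact hXY.trans (hQY.symm_of_card_le (hmax Y (hX.trans hXY.isConj)))

end IsGeneratedAbove

section SupCentralizer

variable {F : FusionSystem S} {p : ℕ} {Q R R' W X Y : Subgroup S} {σ : Equiv.Perm S}

/-- `X C_S(X)`. -/
def supCentralizer (X : Subgroup S) : Subgroup S := X ⊔ C[X]

theorem le_supCentralizer (X : Subgroup S) : X ≤ supCentralizer X := le_sup_left

theorem supCentralizer_le_normalizer (X : Subgroup S) : supCentralizer X ≤ N[X] :=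
  sup_le Subgroup.le_normalizer (Subgroup.centralizer_le_normalizer _)

theorem normalizer_le_normalizer_centralizer (X : Subgroup S) : N[X] ≤ N[C[X]] :=
  (Subgroup.normal_subgroupOf_iff_le_normalizer (Subgroup.centralizer_le_normalizer _)).1
    (Subgroup.normal_subgroupOf_centralizer_normalizer _)

theorem normalizer_le_normalizer_supCentralizer (X : Subgroup S) : N[X] ≤ N[supCentralizer X] :=
  Subgroup.normalizer_le_normalizer_sup_of_normalizer_le_left
    (normalizer_le_normalizer_centralizer X)

theorem Iso.le_supCentralizer (h : F.Iso X Y σ) (hW : F.Iso (supCentralizer X) W σ) :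
    W ≤ supCentralizer Y :=
  hW.le_of_sup (fun _ ha => FusionSystem.le_supCentralizer Y (h.mem_iff.2 ha))
    fun _ hb => Subgroup.mem_sup_right
      (hW.map_mem_centralizer le_sup_left h (Subgroup.mem_sup_right hb) hb)

variable [Finite S]

theorem Iso.supCentralizer (h : F.Iso Q Q σ) (hR : F.Iso R R' σ) (hQR : supCentralizer Q ≤ R) :
    F.Iso (supCentralizer Q) (supCentralizer Q) σ := by
  obtain ⟨W, -, hW⟩ := hR.exists_restrict hQR
  exact Subgroup.eq_of_le_of_card_ge (h.le_supCentralizer hW) hW.card_eq.le ▸ hW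

end SupCentralizer

section Noncentric

variable {F : FusionSystem S} {p : ℕ} {Q R X Y Z : Subgroup S} {σ : Equiv.Perm S}

/-- Restriction to `Y` of the `F`-automorphisms of `Z` that stabilize `Y`. -/
def restrictAut (F : FusionSystem S) (hYZ : Y ≤ Z) : F.stabAut Z Y →* MulAut Y where
  toFun b :=
    { toFun := fun y => ⟨b.1 ⟨y, hYZ y.2⟩, (b.2.2 _).2 y.2⟩
      invFun := fun y => ⟨b.1⁻¹ ⟨y, hYZ y.2⟩, ((inv_mem b.2).2 _).2 y.2⟩
      left_inv := fun y => Subtype.ext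
        (Subtype.ext_iff.1 (MulAut.inv_apply_self Z b.1 ⟨y, hYZ y.2⟩) :)
      right_inv := fun y => Subtype.ext
        (Subtype.ext_iff.1 (MulAut.apply_inv_self Z b.1 ⟨y, hYZ y.2⟩) :)
      map_mul' := fun x y => Subtype.ext
        (Subtype.ext_iff.1 (map_mul b.1 ⟨x, hYZ x.2⟩ ⟨y, hYZ y.2⟩) :) }
  map_one' := rfl
  map_mul' _ _ := rfl

theorem restrictAut_apply (hYZ : Y ≤ Z) (b : F.stabAut Z Y) (y : Y) :
    (F.restrictAut hYZ b y : S) = b.1 ⟨y, hYZ y.2⟩ :=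
  rfl

theorem mem_range_restrictAut_iff (hYZ : Y ≤ Z) {α : MulAut Y} :
    α ∈ (F.restrictAut hYZ).range ↔ ∃ τ, F.Iso Z Z τ ∧ ∀ y : Y, τ y = α y := by
  constructor
  · rintro ⟨b, rfl⟩
    exact ⟨extendAut b.1, iso_extendAut_iff.2 b.2.1, fun y => extendAut_apply b.1 ⟨y, hYZ y.2⟩⟩
  · rintro ⟨τ, hτ, hτα⟩
    obtain ⟨b, hb, hτb⟩ := hτ.exists_aut
    have hY (s : S) : τ s ∈ Y ↔ s ∈ Y := by
      refine ⟨fun hs => ?_, fun hs => hτα ⟨s, hs⟩ ▸ (α _).2⟩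
      obtain ⟨y, hy⟩ := α.surjective ⟨τ s, hs⟩
      have hys : (y : S) = s := τ.injective ((hτα y).trans (congrArg Subtype.val hy))
      exact hys ▸ y.2
    refine ⟨⟨b, hb, fun z => by rw [← hτb, hY]⟩, MulEquiv.ext fun y => Subtype.ext ?_⟩
    rw [restrictAut_apply, ← hτb ⟨y, hYZ y.2⟩, hτα]

theorem range_restrictAut_le (hYZ : Y ≤ Z) : (F.restrictAut hYZ).range ≤ F.Aut Y := by
  rintro _ ⟨b, rfl⟩
  refine (iso_of_mem_stabAut hYZ b.2).mem_aut fun y => ?_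
  rw [extendAut_apply b.1 ⟨y, hYZ y.2⟩, restrictAut_apply]

theorem map_restrictAut_autS (hYZ : Y ≤ Z) (hN : N[Y] ≤ N[Z]) :
    ((autS Z ⊓ F.stabAut Z Y).subgroupOf (F.stabAut Z Y)).map (F.restrictAut hYZ) = autS Y := by
  ext α
  constructor
  · rintro ⟨b, hb, rfl⟩
    obtain ⟨-, g, hg, hbg⟩ := autS_inf_stabAut_le hYZ (Subgroup.mem_subgroupOf.1 hb)
    exact mem_autS_iff.2 ⟨g, hg.2, fun y => hbg ⟨y, hYZ y.2⟩ y.2⟩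
  · intro hα
    obtain ⟨g, hg, hαg⟩ := mem_autS_iff.1 hα
    let b : MulAut Z := Z.normalizerMonoidHom ⟨g, hN hg⟩
    have hb : b ∈ autS Z := ⟨_, rfl⟩
    have hbY : b ∈ F.stabAut Z Y :=
      ⟨F.autS_le_aut Z hb, fun z => (Subgroup.mem_normalizer_iff.1 hg z).symm⟩
    exact ⟨⟨b, hbY⟩, ⟨hb, hbY⟩, MulEquiv.ext fun y => Subtype.ext (hαg y).symm⟩

theorem IsNormalizerTerminal.lt_supCentralizer (hQ : F.IsNormalizerTerminal Q)
    (hX : F.IsConj X Q) (hC : ¬ C[X] ≤ X) : Q < supCentralizer Q := by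
  obtain ⟨σ, W, hσ, hσN⟩ := hQ X hX
  obtain ⟨U, -, hU⟩ := hσN.exists_restrict (supCentralizer_le_normalizer X)
  exact (hσ.lt_of_lt hU (left_lt_sup.2 hC)).trans_le (hσ.le_supCentralizer hU)

theorem exists_iso_eqOn_of_aut_le_range (hQZ : Q ≤ Z) (hQ : F.IsNormalizerTerminal Q)
    (hext : F.Aut Q ≤ (F.restrictAut hQZ).range) (hσ : F.Iso X Q σ) :
    ∃ φ β W, F.Iso X Q φ ∧ F.Iso N[X] W φ ∧ F.Iso Z Z β ∧ F.Iso Q Q β ∧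
      ∀ x ∈ X, β (φ x) = σ x := by
  obtain ⟨φ, W, hφ, hφN⟩ := hQ X hσ.isConj
  obtain ⟨α, hα, hσα⟩ := (hφ.symm.trans hσ).exists_aut
  obtain ⟨β, hβ, hβα⟩ := (mem_range_restrictAut_iff hQZ).1 (hext hα)
  refine ⟨φ, β, W, hφ, hφN, hβ, iso_of_mem_aut hα hβα, fun x hx => ?_⟩
  rw [hβα ⟨φ x, hφ.mem_iff.2 hx⟩, ← hσα]
  simp

variable [Finite S] [Fact p.Prime]

theorem exists_mem_normalizer_inf_centralizer (hS : IsPGroup p S) (hRN : R ≤ N[X])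
    (hC : ¬ C[X] ≤ R) : ∃ d ∈ N[R] ⊓ C[X], d ∉ R := by
  obtain ⟨m, ⟨hm, hmN⟩, hmR⟩ := SetLike.exists_of_lt
    (lt_inf_normalizer (hS.to_subgroup _) (left_lt_sup.2 hC))
  have hm' : m ∈ ((R ⊔ C[X] : Subgroup S) : Set S) := hm
  rw [Subgroup.coe_mul_of_left_le_normalizer_right _ _
    (hRN.trans (normalizer_le_normalizer_centralizer X))] at hm'
  obtain ⟨r, hr, d, hd, rfl⟩ := hm'
  refine ⟨d, ⟨?_, hd⟩, fun hdR => hmR (R.mul_mem hr hdR)⟩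
  exact ((N[R]).mul_mem_cancel_left (Subgroup.le_normalizer hr)).1 hmN

theorem IsSaturatedPair.exists_extend_lt (hS : IsPGroup p S) (h : F.IsSaturatedPair p Z Y)
    (hR : F.Iso R Z σ) (hX : F.Iso X Y σ) (hRN : R ≤ N[X]) (hC : ¬ C[X] ≤ R) :
    ∃ τ V W, (∀ x ∈ X, τ x = σ x) ∧ R < V ∧ V ≤ N[X] ∧ F.Iso V W τ := by
  obtain ⟨d, hd, hdR⟩ := exists_mem_normalizer_inf_centralizer hS hRN hC
  have hCN : C[X] ≤ N[X] := Subgroup.centralizer_le_normalizer _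
  obtain ⟨τ, V, W, -, hτ, hRV, hDV, hV⟩ := h.exists_extend_eqOn hS hR hX
    (inf_le_inf_left N[R] hCN) fun d hd => ⟨1, one_mem _, fun x hx => by
      simp [← Subgroup.mem_centralizer_iff.1 hd.2 x hx]⟩
  obtain ⟨W', -, hW'⟩ := hV.exists_restrict (inf_le_left : V ⊓ N[X] ≤ V)
  exact ⟨τ, V ⊓ N[X], W', hτ, lt_of_le_of_ne (le_inf hRV hRN) fun heq =>
    hdR (heq ▸ ⟨hDV hd, hCN hd.2⟩), inf_le_right, hW'⟩

theorem IsNormalizerTerminal.exists_iso_supCentralizer (hQ : F.IsNormalizerTerminal Q)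
    (hS : IsPGroup p S)
    (hsat : ∀ R : Subgroup S, Nat.card Q < Nat.card R → F.IsSaturatedAt p R) (R : Subgroup S) :
    ∀ R' σ, F.Iso Q Q σ → Q < R → R ≤ N[Q] → F.Iso R R' σ →
      ∃ τ, F.Iso (supCentralizer Q) (supCentralizer Q) τ ∧ ∀ x ∈ Q, τ x = σ x := by
  induction R using induction_card_gt with | step R ih
  intro R' σ h hQR hRN hR
  by_cases hCR : C[Q] ≤ R
  · exact ⟨σ, h.supCentralizer hR (sup_le hQR.le hCR), fun _ _ => rfl⟩
  have hQR' : Q < R' := h.lt_of_lt hR hQR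
  by_cases hCR' : C[Q] ≤ R'
  · have hσ := h.symm.supCentralizer hR.symm (sup_le hQR'.le hCR')
    exact ⟨σ, by simpa using hσ.symm, fun _ _ => rfl⟩
  obtain ⟨Z, Q₁, χ, V, W, hpair, hχR, hχ, -, hV, hχV⟩ :=
    (hsat R (card_lt_card_of_lt hQR)).exists_isSaturatedPair hS hQR.le
  obtain ⟨θ, W₁, hθ, hθN⟩ := hQ Q₁ hχ.symm.isConj
  have hext {U U' ρ} (hU : F.Iso U U' ρ) (hρ : F.Iso Q Q₁ ρ) (hQU : Q < U) (hUN : U ≤ N[Q])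
      (hRU : Nat.card R < Nat.card U) :
      ∃ τ, F.Iso (supCentralizer Q) (supCentralizer Q) τ ∧ ∀ x ∈ Q, τ x = θ (ρ x) := by
    obtain ⟨U'', -, hU''⟩ := hθN.exists_restrict (hU.le_normalizer hρ hQU.le hUN)
    exact ih U hRU U'' (θ * ρ) (hρ.trans hθ) hQU hUN (hU.trans hU'')
  have hlt : R < N[R] ⊓ N[Q] := by
    simpa only [inf_comm] using lt_inf_normalizer (hS.to_subgroup _)
      (lt_of_le_not_ge hRN fun h => hCR ((Subgroup.centralizer_le_normalizer _).trans h))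
  obtain ⟨R₁, -, hR₁⟩ := hχV.exists_restrict hV
  obtain ⟨τ₁, hτ₁, hτ₁χ⟩ :=
    hext hR₁ hχ (hQR.trans hlt) inf_le_right (card_lt_card_of_lt hlt)
  obtain ⟨ξ, V', W', hξσ, hRV', hVN', hξV'⟩ := hpair.exists_extend_lt hS (hR.symm.trans hχR)
    (h.symm.trans hχ) (hR.le_normalizer h hQR.le hRN) hCR'
  obtain ⟨τ₂, hτ₂, hτ₂ξ⟩ := hext hξV' ((h.symm.trans hχ).congr hξσ) (hQR'.trans hRV') hVN'
    (hR.card_eq.trans_lt (card_lt_card_of_lt hRV'))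
  refine ⟨τ₂⁻¹ * τ₁, hτ₁.trans hτ₂.symm, fun x hx => ?_⟩
  have hσx : σ x ∈ Q := h.mem_iff.2 hx
  rw [Equiv.Perm.mul_apply, Equiv.Perm.inv_eq_iff_eq, hτ₁χ x hx, hτ₂ξ _ hσx, hξσ _ hσx]
  simp

theorem IsSaturatedPair.isFullyAutomized (h : F.IsSaturatedPair p Z Q) (hN : N[Q] ≤ N[Z])
    (hext : F.Aut Q ≤ (F.restrictAut h.le).range) : F.IsFullyAutomized p Q := by
  have hsyl := h.isSylowIn.map_range (F.restrictAut h.le)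
  rwa [map_restrictAut_autS h.le hN, le_antisymm (range_restrictAut_le h.le) hext] at hsyl

theorem IsSaturatedPair.isReceptive_of_isNormalizerTerminal (hS : IsPGroup p S)
    (h : F.IsSaturatedPair p Z Q) (hN : N[Q] ≤ N[Z]) (hQ : F.IsNormalizerTerminal Q)
    (hext : F.Aut Q ≤ (F.restrictAut h.le).range) : F.IsReceptive Q := by
  refine isReceptive_iff.2 fun X σ hσ D hD hDσ => ?_
  obtain ⟨φ, β, W, hφ, hφN, hβ, hβQ, hβφ⟩ := exists_iso_eqOn_of_aut_le_range h.le hQ hext hσ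
  obtain ⟨D', hD'W, hφD⟩ := hφN.exists_restrict hD
  have hD'N : D' ≤ N[Q] := hD'W.trans (hφN.le_normalizer hφ Subgroup.le_normalizer le_rfl)
  have hD'β : ∀ d ∈ D', ∃ g ∈ N[Z] ⊓ N[Q], ∀ x ∈ Q, β (d * x * d⁻¹) = g * β x * g⁻¹ := by
    intro d' hd'
    obtain ⟨d, hd, rfl⟩ := hφD.exists_apply_eq hd'
    obtain ⟨g, hg, hσg⟩ := hDσ d hd
    refine ⟨g, ⟨hN hg, hg⟩, fun y hy => ?_⟩
    obtain ⟨x, hx, rfl⟩ := hφ.exists_apply_eq hy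
    rw [← hφN.map_conj (hD hd) (Subgroup.le_normalizer hx), hβφ x hx, ← hσg x hx]
    exact hβφ _ ((Subgroup.mem_normalizer_iff.1 (hD hd) x).1 hx)
  obtain ⟨τ, V, U, -, hτβ, hZV, hD'V, hτV⟩ :=
    h.exists_extend_eqOn hS hβ hβQ (le_inf (hD'N.trans hN) hD'N) hD'β
  obtain ⟨W', -, hφW'⟩ := hφN.exists_restrict (sup_le Subgroup.le_normalizer hD)
  have hW'V : W' ≤ V := hφW'.le_of_sup (fun x hx => hZV (h.le (hφ.mem_iff.2 hx)))
    fun d hd => hD'V (hφD.mem_iff.2 hd)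
  obtain ⟨U', -, hτ⟩ := hτV.exists_restrict hW'V
  refine ⟨τ * φ, X ⊔ D, U', le_sup_left, le_sup_right, hφW'.trans hτ, fun x hx => ?_⟩
  rw [Equiv.Perm.mul_apply, hτβ _ (hφ.mem_iff.2 hx), hβφ x hx]

theorem IsNormalizerTerminal.exists_isSaturatedPair_supCentralizer
    (hQ : F.IsNormalizerTerminal Q) (hS : IsPGroup p S)
    (hsat : F.IsSaturatedAt p (supCentralizer Q)) :
    ∃ Y, F.IsConj Q Y ∧ F.IsNormalizerTerminal Y ∧ F.IsSaturatedPair p (supCentralizer Y) Y := by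
  obtain ⟨Z, Y, χ, V, W, hpair, hχZ, hχ, -, hV, hχV⟩ :=
    hsat.exists_isSaturatedPair hS (le_supCentralizer Q)
  have hNV : N[Q] ≤ V := (le_inf (normalizer_le_normalizer_supCentralizer Q) le_rfl).trans hV
  have hY : F.IsNormalizerTerminal Y := fun X hX =>
    (hQ X (hX.trans hχ.symm.isConj)).trans (hχ.isNormalizerConj hχV hNV)
  have hZ : Z = supCentralizer Y := by
    obtain ⟨θ, U, hθ, hθN⟩ := hQ Y hχ.symm.isConj
    obtain ⟨U', -, hU'⟩ := hθN.exists_restrict (supCentralizer_le_normalizer Y)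
    refine Subgroup.eq_of_le_of_card_ge (hχ.le_supCentralizer hχZ) ?_
    rw [hU'.card_eq, ← hχZ.card_eq]
    exact Subgroup.card_le_of_le (hθ.le_supCentralizer hU')
  exact ⟨Y, hχ.isConj, hY, hZ ▸ hpair⟩

theorem IsGeneratedAbove.aut_le_extAut (hgen : F.IsGeneratedAbove X) (hS : IsPGroup p S)
    (hXQ : F.IsConj X Q) (hQ : F.IsNormalizerTerminal Q) : F.Aut Q ≤ F.extAut Q := by
  intro α hα
  have hα' : F.Transports (F.extAut Q) Q Q (extendAut α) :=
    hgen _ (isGroupoidal_transports hQ) (fun X Y R R' σ _ hXR h hR =>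
      Transports.of_extends hS le_rfl h hXR hR) Q Q _ hXQ (iso_extendAut_iff.2 hα)
  obtain ⟨β, hβ, hαβ⟩ := hα'.exists_mem
  have heq : α = β := MulEquiv.ext fun x => Subtype.ext (by rw [← hαβ, extendAut_apply])
  exact heq ▸ hβ

theorem IsNormalizerTerminal.extAut_le_range_restrictAut (hQ : F.IsNormalizerTerminal Q)
    (hS : IsPGroup p S)
    (hsat : ∀ R : Subgroup S, Nat.card Q < Nat.card R → F.IsSaturatedAt p R) :
    F.extAut Q ≤ (F.restrictAut (le_supCentralizer Q)).range := by
  refine extAut_le_iff.2 fun α V W ρ hV hρ hρQ hρα => (mem_range_restrictAut_iff _).2 ?_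
  obtain ⟨U, -, hU⟩ := hρ.exists_restrict (inf_le_left : V ⊓ N[Q] ≤ V)
  obtain ⟨τ, hτ, hτρ⟩ := hQ.exists_iso_supCentralizer hS hsat _ U ρ hρQ
    (lt_inf_normalizer (hS.to_subgroup V) hV) inf_le_right hU
  exact ⟨τ, hτ, fun x => (hτρ x x.2).trans (hρα x)⟩

theorem IsGeneratedAbove.isSaturatedAt (hgen : F.IsGeneratedAbove X) (hS : IsPGroup p S)
    (hsat : ∀ R : Subgroup S, Nat.card X < Nat.card R → F.IsSaturatedAt p R)
    (hXY : F.IsConj X Y) (hC : ¬ C[Y] ≤ Y) : F.IsSaturatedAt p X := by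
  have hX : X < ⊤ := lt_of_le_of_card_lt le_top (hXY.card_eq.trans_lt
    (card_lt_card_of_lt ((left_lt_sup.2 hC).trans_le le_top)))
  obtain ⟨Q₁, hXQ₁, hQ₁⟩ := hgen.exists_isNormalizerTerminal hS hX hsat
  obtain ⟨Q, hQ₁Q, hQ, hpair⟩ := hQ₁.exists_isSaturatedPair_supCentralizer hS (hsat _
    (hXQ₁.card_eq.trans_lt (card_lt_card_of_lt
      (hQ₁.lt_supCentralizer (hXY.symm.trans hXQ₁) hC))))
  have hXQ : F.IsConj X Q := hXQ₁.trans hQ₁Q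
  have hext : F.Aut Q ≤ (F.restrictAut hpair.le).range :=
    (hgen.aut_le_extAut hS hXQ hQ).trans
      (hQ.extAut_le_range_restrictAut hS fun R hR => hsat R (hXQ.card_eq.trans_lt hR))
  have hN : N[Q] ≤ N[supCentralizer Q] := normalizer_le_normalizer_supCentralizer Q
  exact ⟨Q, hXQ, hpair.isFullyAutomized hN hext,
    hpair.isReceptive_of_isNormalizerTerminal hS hN hQ hext⟩

end Noncentric

section Centric

variable {F : FusionSystem S} {E R X Y : Subgroup S}

theorem isSCentric_iff : IsSCentric X ↔ C[X] ≤ X := by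
  refine ⟨fun h => ?_, fun h => le_antisymm (fun s hs => ?_) ?_⟩
  · rw [IsSCentric] at h
    exact h ▸ Subgroup.map_subtype_le _
  · refine ⟨⟨s, h hs⟩, Subgroup.mem_center_iff.2 fun x => Subtype.ext ?_, rfl⟩
    exact Subgroup.mem_centralizer_iff.1 hs x x.2
  · rintro _ ⟨z, hz, rfl⟩
    exact Subgroup.mem_centralizer_iff.2 fun x hx =>
      congrArg Subtype.val (Subgroup.mem_center_iff.1 hz ⟨x, hx⟩)

theorem IsSCentric.mono (h : IsSCentric X) (hXR : X ≤ R) : IsSCentric R :=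
  isSCentric_iff.2 ((Subgroup.centralizer_le hXR).trans ((isSCentric_iff.1 h).trans hXR))

theorem IsCentric.isSCentric (h : F.IsCentric X) : IsSCentric X :=
  h X (IsConj.refl F X)

theorem IsCentric.of_isConj (h : F.IsCentric X) (hXY : F.IsConj X Y) : F.IsCentric Y :=
  fun Z hZ => h Z (hXY.trans hZ)

theorem IsCentric.mono [Finite S] (h : F.IsCentric X) (hXR : X ≤ R) : F.IsCentric R := by
  intro R' hR'
  obtain ⟨σ, hσ⟩ := hR'.exists_iso
  obtain ⟨X', hX', hσX⟩ := hσ.exists_restrict hXR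
  exact (h X' hσX.isConj).mono hX'

theorem IsNormalizerConj.isSCentric (h : F.IsNormalizerConj X Y) (hY : IsSCentric Y) :
    IsSCentric X := by
  obtain ⟨σ, W, hσ, hN⟩ := h
  refine isSCentric_iff.2 fun s hs => hσ.mem_iff.1 (isSCentric_iff.1 hY ?_)
  exact hN.map_mem_centralizer Subgroup.le_normalizer hσ
    (Subgroup.centralizer_le_normalizer _ hs) hs

theorem autS_le_extAut (hE : E < N[E]) : autS E ≤ F.extAut E := by
  intro α hα
  obtain ⟨g, hg, hαg⟩ := mem_autS_iff.1 hα
  exact mem_extAut_of_iso (F.autS_le_aut E hα) (Iso.conj_self_iff.2 (Subgroup.le_normalizer hg)) hE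
    fun x => (hαg x).symm

theorem inn_le_autS (E : Subgroup S) : inn E ≤ autS E := by
  rintro _ ⟨x, rfl⟩
  exact mem_autS_iff.2 ⟨x, Subgroup.le_normalizer x.2, fun z => rfl⟩

theorem isPGroup_inn {p : ℕ} (hS : IsPGroup p S) (E : Subgroup S) : IsPGroup p (inn E) :=
  (isPGroup_autS hS E).to_le (inn_le_autS E)

theorem mem_of_mem_inn (hE : IsSCentric E) {α : MulAut E} (hα : α ∈ inn E) {g : S}
    (hαg : ∀ z : E, (α z : S) = g * z * g⁻¹) : g ∈ E := by
  obtain ⟨x, rfl⟩ := hα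
  have hxg : (x : S)⁻¹ * g ∈ C[E] := Subgroup.mem_centralizer_iff.2 fun z hz => by
    have hz' : (x : S) * z * (x : S)⁻¹ = g * z * g⁻¹ := hαg ⟨z, hz⟩
    calc z * ((x : S)⁻¹ * g) = (x : S)⁻¹ * (x * z * (x : S)⁻¹) * g := by group
      _ = (x : S)⁻¹ * g * z := by rw [hz']; group
  simpa using E.mul_mem x.2 (isSCentric_iff.1 hE hxg)

theorem normalizerMonoidHom_notMem_inn (hE : IsSCentric E) {g : S} (hg : g ∈ N[E]) (hgE : g ∉ E) :
    E.normalizerMonoidHom ⟨g, hg⟩ ∉ inn E :=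
  fun h => hgE (mem_of_mem_inn hE h fun _ => rfl)

end Centric

section FullyNormalized

variable {F : FusionSystem S} {p : ℕ} {Q X Y : Subgroup S} {σ : Equiv.Perm S}

theorem coe_congr_apply {e : X ≃* Y} (hσ : ∀ x : X, σ x = e x) (α : MulAut X) (x : X) :
    (MulAut.congr e α (e x) : S) = σ (α x) := by
  rw [hσ]
  simp [MulAut.congr]

theorem map_congr_aut {e : X ≃* Y} (he : e.toMonoidHom ∈ F.Hom X Y) :
    (F.Aut X).map (MulAut.congr e).toMonoidHom = F.Aut Y := by
  ext β
  constructor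
  · rintro ⟨α, hα, rfl⟩
    exact F.comp_mem (F.comp_mem (F.symm_mem he) hα) he
  · intro hβ
    exact ⟨(MulAut.congr e).symm β, F.comp_mem (F.comp_mem he hβ) (F.symm_mem he),
      (MulAut.congr e).apply_symm_apply β⟩

theorem map_congr_autS (hN : F.Iso N[X] N[Y] σ) {e : X ≃* Y} (hσ : ∀ x : X, σ x = e x) :
    (autS X).map (MulAut.congr e).toMonoidHom = autS Y := by
  have hconj {g : S} (hg : g ∈ N[X]) (x : X) :
      (MulAut.congr e (X.normalizerMonoidHom ⟨g, hg⟩) (e x) : S) = σ g * e x * (σ g)⁻¹ := by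
    rw [coe_congr_apply hσ, ← hσ, ← hN.map_conj hg (Subgroup.le_normalizer x.2)]
    rfl
  ext β
  constructor
  · rintro ⟨_, ⟨g, rfl⟩, rfl⟩
    refine mem_autS_iff.2 ⟨σ g, hN.mem_iff.2 g.2, fun y => ?_⟩
    obtain ⟨x, rfl⟩ := e.surjective y
    exact hconj g.2 x
  · intro hβ
    obtain ⟨_, hg', hβg⟩ := mem_autS_iff.1 hβ
    obtain ⟨g, hg, rfl⟩ := hN.exists_apply_eq hg'
    refine ⟨X.normalizerMonoidHom ⟨g, hg⟩, ⟨_, rfl⟩, MulEquiv.ext fun y => Subtype.ext ?_⟩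
    obtain ⟨x, rfl⟩ := e.surjective y
    exact (hconj hg x).trans (hβg (e x)).symm

variable [Finite S]

theorem exists_isFullyNormalized (F : FusionSystem S) (X : Subgroup S) :
    ∃ Q, F.IsConj X Q ∧ F.IsFullyNormalized Q := by
  obtain ⟨Q, hQ, hmax⟩ := F.exists_isConj_forall_card_normalizer_le X
  exact ⟨Q, hQ, fun Y hY => hmax Y (hQ.trans hY)⟩

theorem IsReceptive.of_iso_normalizer (hY : F.IsReceptive Y) (hσ : F.Iso X Y σ)
    (hN : F.Iso N[X] N[Y] σ) : F.IsReceptive X := by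
  refine isReceptive_iff.2 fun R ρ hρ D hD hDρ => ?_
  have hDσ : ∀ d ∈ D, ∃ g ∈ N[Y], ∀ r ∈ R, (σ * ρ) (d * r * d⁻¹) = g * (σ * ρ) r * g⁻¹ := by
    intro d hd
    obtain ⟨g, hg, hρg⟩ := hDρ d hd
    refine ⟨σ g, hN.mem_iff.2 hg, fun r hr => ?_⟩
    rw [Equiv.Perm.mul_apply, hρg r hr,
      hN.map_conj hg (Subgroup.le_normalizer (hρ.mem_iff.2 hr)), Equiv.Perm.mul_apply]
  obtain ⟨τ, V, W, hRV, hDV, hτ, hτρ⟩ :=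
    isReceptive_iff.1 hY R (σ * ρ) (hρ.trans hσ) D hD hDσ
  obtain ⟨W₁, -, hW₁⟩ := hτ.exists_restrict (inf_le_left : V ⊓ N[R] ≤ V)
  have hRVN : R ≤ V ⊓ N[R] := le_inf hRV Subgroup.le_normalizer
  obtain ⟨W₂, -, hW₂⟩ := hN.symm.exists_restrict
    (hW₁.le_normalizer ((hρ.trans hσ).congr hτρ) hRVN inf_le_right)
  refine ⟨σ⁻¹ * τ, V ⊓ N[R], W₂, hRVN, le_inf hDV hD, hW₁.trans hW₂, fun r hr => ?_⟩
  rw [Equiv.Perm.mul_apply, hτρ r hr]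
  simp

variable [Fact p.Prime]

theorem IsFullyAutomized.of_iso_normalizer (hX : F.IsFullyAutomized p X) (hσ : F.Iso X Y σ)
    (hN : F.Iso N[X] N[Y] σ) : F.IsFullyAutomized p Y := by
  obtain ⟨e, he, hσ⟩ := hσ
  have hsyl := IsSylowIn.map (B := F.Aut X) hX (MulAut.congr e).toMonoidHom
  rwa [map_congr_aut he, map_congr_autS hN hσ] at hsyl

theorem IsFullyNormalized.isFullyAutomized_and_isReceptive (hQ : F.IsFullyNormalized Q)
    (hS : IsPGroup p S) (hsat : F.IsSaturatedAt p Q) :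
    F.IsFullyAutomized p Q ∧ F.IsReceptive Q := by
  obtain ⟨Y, hQY, haut, hrec⟩ := hsat
  obtain ⟨σ, hσ, hN⟩ := (hQY.isNormalizerConj hS haut hrec).exists_iso_normalizer (hQ Y hQY)
  exact ⟨haut.of_iso_normalizer hσ.symm hN.symm, hrec.of_iso_normalizer hσ hN⟩

theorem IsFullyNormalized.isNormalizerTerminal (hQ : F.IsFullyNormalized Q) (hS : IsPGroup p S)
    (hsat : F.IsSaturatedAt p Q) : F.IsNormalizerTerminal Q := fun _ hX => by
  obtain ⟨haut, hrec⟩ := hQ.isFullyAutomized_and_isReceptive hS hsat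
  exact hX.isNormalizerConj hS haut hrec

end FullyNormalized

section StronglyPEmbedded

variable [Finite S] {F G : FusionSystem S} {p : ℕ} {E V W : Subgroup S} {ρ : Equiv.Perm S}
  {α β : MulAut E}

theorem IsReceptive.mem_extAut (hrec : F.IsReceptive E) (hβ : β ∈ F.Aut E) (hα : α ∈ autS E)
    (hαi : α ∉ inn E) (hβα : β * α * β⁻¹ ∈ autS E) : β ∈ F.extAut E := by
  obtain ⟨g, rfl⟩ := hα
  have hgE : (g : S) ∉ E := fun h => hαi ⟨⟨g, h⟩, MulEquiv.ext fun _ => Subtype.ext rfl⟩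
  have hconj : ∀ d ∈ Subgroup.zpowers (g : S), ∃ k ∈ N[E], ∀ z ∈ E,
      extendAut β (d * z * d⁻¹) = k * extendAut β z * k⁻¹ := by
    intro d hd
    obtain ⟨n, rfl⟩ := Subgroup.mem_zpowers_iff.1 hd
    have hβn : β * E.normalizerMonoidHom g ^ n * β⁻¹ ∈ autS E := by
      simpa only [conj_zpow] using zpow_mem hβα n
    obtain ⟨k, hk, hβk⟩ := mem_autS_iff.1 hβn
    refine ⟨k, hk, fun z hz => ?_⟩
    rw [extendAut_apply β ⟨z, hz⟩, ← hβk, MulAut.mul_apply, MulAut.mul_apply,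
      MulAut.inv_apply_self, ← extendAut_apply, ← map_zpow]
    rfl
  obtain ⟨τ, V, W, hEV, hgV, hτ, hτβ⟩ := isReceptive_iff.1 hrec E (extendAut β)
    (iso_extendAut_iff.2 hβ) (Subgroup.zpowers g) (by simp) hconj
  have hlt : E < V := lt_of_le_of_ne hEV fun h => hgE (h.ge (hgV (Subgroup.mem_zpowers (g : S))))
  exact mem_extAut_of_iso hβ hτ hlt fun z => by rw [hτβ z z.2, extendAut_apply]

theorem extAut_eq_closure (F : FusionSystem S) (E : Subgroup S) :
    F.extAut E = Subgroup.closure {α : MulAut E | ∃ V W ρ, E < V ∧ F.Iso V W ρ ∧ F.Iso E E ρ ∧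
      ∀ x : E, ρ x = α x} := by
  refine le_antisymm (extAut_le_iff.2 fun α V W ρ hV hρ hρE hα =>
    Subgroup.subset_closure ⟨V, W, ρ, hV, hρ, hρE, hα⟩) ((Subgroup.closure_le _).2 ?_)
  rintro α ⟨V, W, ρ, hV, hρ, hρE, hα⟩
  exact mem_extAut_of_iso (hρE.mem_aut hα) hρ hV hα

variable [Fact p.Prime]

theorem exists_mem_autS_conj_mem_autS (hS : IsPGroup p S) (hE : IsSCentric E) (hV : E < V)
    (hρ : F.Iso V W ρ) (hρE : F.Iso E E ρ) (hβ : ∀ x : E, ρ x = β x) :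
    ∃ α ∈ autS E, α ∉ inn E ∧ β * α * β⁻¹ ∈ autS E := by
  obtain ⟨g, ⟨hgV, hg⟩, hgE⟩ := SetLike.exists_of_lt (lt_inf_normalizer (hS.to_subgroup V) hV)
  refine ⟨E.normalizerMonoidHom ⟨g, hg⟩, ⟨_, rfl⟩, normalizerMonoidHom_notMem_inn hE hg hgE,
    mem_autS_iff.2 ⟨ρ g, (hρ.mem_normalizer_iff hV.le hρE hgV).2 hg, fun z => ?_⟩⟩
  obtain ⟨x, rfl⟩ := β.surjective z
  rw [MulAut.mul_apply, MulAut.mul_apply, MulAut.inv_apply_self, ← hβ, ← hβ,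
    ← hρ.map_conj hgV (hV.le x.2)]
  rfl

theorem exists_isStronglyPEmbedded (hS : IsPGroup p S) (hE : E < ⊤) (hc : IsSCentric E)
    (haut : G.IsFullyAutomized p E) (hrec : F.IsReceptive E) (hGF : G.Aut E ≤ F.Aut E)
    (hlt : F.extAut E < G.Aut E) : ∃ M : Subgroup (G.Out E), IsStronglyPEmbedded p M := by
  have hEN := lt_normalizer hS hE
  obtain ⟨T, hT⟩ := haut
  have hmem {x : G.Aut E} : x ∈ T ↔ (x : MulAut E) ∈ autS E := mem_iff_of_map_subtype_eq hT
  refine ⟨_, isStronglyPEmbedded_of_controls (H := (F.extAut E).subgroupOf (G.Aut E))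
    (isPGroup_subgroupOf (isPGroup_inn hS E) _) T ?_ ?_ ?_ ?_ ?_⟩
  · exact fun x hx => autS_le_extAut hEN (hmem.1 hx)
  · exact fun x hx => autS_le_extAut hEN (inn_le_autS E hx)
  · obtain ⟨g, hg, hgE⟩ := SetLike.exists_of_lt hEN
    exact ⟨⟨_, G.autS_le_aut E ⟨⟨g, hg⟩, rfl⟩⟩, hmem.2 ⟨_, rfl⟩,
      normalizerMonoidHom_notMem_inn hc hg hgE⟩
  · rw [Ne, Subgroup.subgroupOf_eq_top]
    exact hlt.not_ge
  · exact fun β x hx hxi hβx => hrec.mem_extAut (hGF β.2) (hmem.1 hx) hxi (hmem.1 hβx)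

theorem not_isStronglyPEmbedded_of_aut_eq_extAut (hS : IsPGroup p S) (hc : IsSCentric E)
    (haut : G.IsFullyAutomized p E) (heq : G.Aut E = F.extAut E) (M : Subgroup (G.Out E)) :
    ¬ IsStronglyPEmbedded p M := by
  obtain ⟨T, hT⟩ := haut
  rw [extAut_eq_closure] at heq
  have hclosure {s : Set (MulAut E)} {B : Subgroup (MulAut E)} (h : B = Subgroup.closure s) :
      Subgroup.closure ((↑) ⁻¹' s : Set B) = ⊤ := by
    subst h
    exact Subgroup.closure_closure_coe_preimage
  refine not_isStronglyPEmbedded_of_closure_eq_top (isPGroup_subgroupOf (isPGroup_inn hS E) _) T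
    (hclosure heq) ?_ M
  rintro β ⟨V, W, ρ, hV, hρ, hρE, hβ⟩
  obtain ⟨α, hα, hαi, hβα⟩ := exists_mem_autS_conj_mem_autS hS hc hV hρ hρE hβ
  exact ⟨⟨α, G.autS_le_aut E hα⟩, (mem_iff_of_map_subtype_eq hT).2 hα, hαi,
    (mem_iff_of_map_subtype_eq hT).2 hβα⟩

end StronglyPEmbedded

section IsLEAbove

variable {F G : FusionSystem S} {p : ℕ} {E Q X Y : Subgroup S} {σ : Equiv.Perm S}

theorem IsConj.mono (hGF : G ≤ F) (h : G.IsConj X Y) : F.IsConj X Y := by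
  obtain ⟨e, he⟩ := h
  exact ⟨e, hGF X Y he⟩

theorem IsCentric.of_le (hGF : G ≤ F) (h : F.IsCentric Q) : G.IsCentric Q :=
  fun Y hY => h Y (hY.mono hGF)

theorem IsFullyNormalized.of_le (hGF : G ≤ F) (h : F.IsFullyNormalized Q) :
    G.IsFullyNormalized Q :=
  fun Y hY => h Y (hY.mono hGF)

/-- `G` contains the isomorphisms of `F` between any two subgroups that properly contain
`F`-conjugates of `E`. -/
def IsLEAbove (F G : FusionSystem S) (E : Subgroup S) : Prop :=
  ∀ X V W σ, F.IsConj E X → X < V → F.Iso V W σ → G.Iso V W σ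

theorem IsLEAbove.of_isConj (h : F.IsLEAbove G X) (hXY : F.IsConj X Y) : F.IsLEAbove G Y :=
  fun Z V W σ hYZ => h Z V W σ (hXY.trans hYZ)

variable [Finite S]

theorem IsConj.eq_top (h : F.IsConj X Y) (hX : X = ⊤) : Y = ⊤ := by
  subst hX
  exact Subgroup.eq_top_of_card_eq _ (h.card_eq.symm.trans Subgroup.card_top)

theorem IsLEAbove.extAut_le_aut (h : F.IsLEAbove G E) : F.extAut E ≤ G.Aut E :=
  extAut_le_iff.2 fun _ V W ρ hV hρ hρE hα =>
    ((h E V W ρ (.refl F E) hV hρ).restrict hV.le fun _ => hρE.mem_iff).mem_aut hα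

theorem IsReceptive.of_isLEAbove (hQ : F.IsReceptive Q) (hGF : G ≤ F) (h : F.IsLEAbove G Q) :
    G.IsReceptive Q := by
  refine isReceptive_iff.2 fun R σ hσ D hD hDσ => ?_
  obtain ⟨τ, V, W, hRV, hDV, hτ, hτσ⟩ := isReceptive_iff.1 hQ R σ (hσ.mono hGF) D hD hDσ
  rcases hRV.eq_or_lt with rfl | hlt
  · exact ⟨σ, R, Q, le_rfl, hDV, hσ, fun _ _ => rfl⟩
  · exact ⟨τ, V, W, hRV, hDV, h R V W τ (hσ.mono hGF).isConj.symm hlt hτ, hτσ⟩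

variable [Fact p.Prime]

theorem IsFullyAutomized.of_le (hGF : G ≤ F) (h : F.IsFullyAutomized p Q) :
    G.IsFullyAutomized p Q :=
  IsSylowIn.mono (B := F.Aut Q) h (G.autS_le_aut Q) (aut_mono hGF Q)

theorem IsNormalizerConj.exists_iso_of_isLEAbove (hX : F.IsNormalizerConj X E)
    (hS : IsPGroup p S) (h : F.IsLEAbove G E) : ∃ τ, F.Iso X E τ ∧ G.Iso X E τ := by
  rcases eq_or_ne X ⊤ with rfl | hXtop
  · rw [hX.isConj.eq_top rfl]
    exact ⟨1, .refl F ⊤, .refl G ⊤⟩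
  · obtain ⟨τ, W, hτ, hN⟩ := hX
    have hlt := lt_normalizer hS (lt_top_iff_ne_top.2 hXtop)
    exact ⟨τ, hτ, (h X _ W τ hτ.isConj.symm hlt hN).restrict hlt.le fun _ => hτ.mem_iff⟩

theorem IsNormalizerConj.isConj_of_isLEAbove (hX : F.IsNormalizerConj X E) (hS : IsPGroup p S)
    (h : F.IsLEAbove G E) : G.IsConj X E := by
  obtain ⟨τ, -, hτ⟩ := hX.exists_iso_of_isLEAbove hS h
  exact hτ.isConj

theorem IsLEAbove.isSaturatedAt (h : F.IsLEAbove G X) (hS : IsPGroup p S) (hGF : G ≤ F)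
    (hsat : F.IsSaturatedAt p X) : G.IsSaturatedAt p X := by
  obtain ⟨Q, hXQ, haut, hrec⟩ := hsat
  have hQ := h.of_isConj hXQ
  exact ⟨Q, (hXQ.isNormalizerConj hS haut hrec).isConj_of_isLEAbove hS hQ, haut.of_le hGF,
    hrec.of_isLEAbove hGF hQ⟩

theorem IsNormalizerTerminal.iso_of_isLEAbove (hE : F.IsNormalizerTerminal E)
    (hS : IsPGroup p S) (h : F.IsLEAbove G E) (haut : F.Aut E ≤ G.Aut E) (hX : F.IsConj X E)
    (hσ : F.Iso X Y σ) : G.Iso X Y σ := by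
  obtain ⟨τ, hτ, hτG⟩ := (hE X hX).exists_iso_of_isLEAbove hS h
  obtain ⟨ρ, hρ, hρG⟩ := (hE Y (hσ.isConj.symm.trans hX)).exists_iso_of_isLEAbove hS h
  obtain ⟨α, hα, hαe⟩ := ((hτ.symm.trans hσ).trans hρ).exists_aut
  exact ((hτG.trans (iso_of_mem_aut (haut hα) hαe)).trans hρG.symm).congr fun x _ => by simp

end IsLEAbove

section Essential

variable [Finite S] {F : FusionSystem S} {p : ℕ} {C : Set (Subgroup S)} {E P R X Y : Subgroup S}

theorem isCentric_top (F : FusionSystem S) : F.IsCentric ⊤ := by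
  intro Y hY
  rw [hY.eq_top rfl]
  exact isSCentric_iff.2 le_top

theorem IsCentric.not_isConj_of_lt (hX : F.IsCentric X)
    (hmin : ∀ Q : Subgroup S, Q < P → ¬ IsSCentric Q) (hXR : X < R) : ¬ F.IsConj R P := by
  intro h
  obtain ⟨σ, hσ⟩ := h.exists_iso
  obtain ⟨Y, -, hY⟩ := hσ.exists_restrict hXR.le
  exact hmin Y (hY.lt_of_lt hσ hXR) (hX Y hY.isConj)

theorem IsEssentialReps.exists_isFullyNormalized (hC : F.IsEssentialReps p C) (X : Subgroup S) :
    ∃ E, F.IsConj X E ∧ F.IsFullyNormalized E ∧ (F.IsEssential p E → E ∈ C) := by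
  obtain ⟨E, hXE, hE⟩ := F.exists_isFullyNormalized X
  by_cases hEss : F.IsEssential p E
  · obtain ⟨E', ⟨hE', hEE'⟩, -⟩ := hC.2 E hEss
    exact ⟨E', hXE.trans hEE', (hC.1 E' hE').2.2.1, fun _ => hE'⟩
  · exact ⟨E, hXE, hE, fun h => (hEss h).elim⟩

variable [Fact p.Prime]

theorem IsFullyNormalized.extAut_eq_aut (hE : F.IsFullyNormalized E) (hS : IsPGroup p S)
    (hsat : F.IsSaturatedAt p E) (hlt : E < ⊤) (hc : F.IsCentric E) (hEss : ¬ F.IsEssential p E) :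
    F.extAut E = F.Aut E := by
  obtain ⟨haut, hrec⟩ := hE.isFullyAutomized_and_isReceptive hS hsat
  by_contra hne
  exact hEss ⟨hlt, hc, hE, exists_isStronglyPEmbedded hS hlt hc.isSCentric haut hrec le_rfl
    (lt_of_le_of_ne (F.extAut_le_aut E) hne)⟩

end Essential

section Prune

variable {F : FusionSystem S} {p : ℕ} {C : Set (Subgroup S)} {P X Y : Subgroup S}
  {K : Subgroup (MulAut P)} {σ : Equiv.Perm S}

theorem le_aut_prune : K ≤ (F.prune C P K).Aut P :=
  fun α hα => mem_aut_generate (Or.inl (Or.inr ⟨α, hα, rfl⟩))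

theorem aut_le_aut_prune {E : Subgroup S} (hE : E ∈ insert ⊤ (C \ {P})) :
    F.Aut E ≤ (F.prune C P K).Aut E := by
  intro α hα
  rcases hE with rfl | hE
  · exact mem_aut_generate (Or.inl (Or.inl ⟨α, hα, rfl⟩))
  · exact mem_aut_generate (Or.inr (Set.mem_iUnion₂.2 ⟨E, hE, α, hα, rfl⟩))

theorem prune_le (hKF : K ≤ F.Aut P) : F.prune C P K ≤ F := by
  refine generate_le ?_
  rintro α ((⟨_, hα, rfl⟩ | ⟨_, hα, rfl⟩) | hα)
  · exact hα
  · exact hKF hα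
  · obtain ⟨_, -, _, hβ, rfl⟩ := Set.mem_iUnion₂.1 hα
    exact hβ

theorem prune_induction {Pr : Subgroup S → Subgroup S → Equiv.Perm S → Prop}
    (hPr : IsGroupoidal Pr)
    (hE : ∀ E ∈ insert ⊤ (C \ {P}), ∀ X ≤ E, ∀ Y σ, (F.prune C P K).Iso E E σ →
      (F.prune C P K).Iso X Y σ → Pr X Y σ)
    (hK : ∀ α ∈ K, ∀ X ≤ P, ∀ Y, (F.prune C P K).Iso X Y (extendAut α) → Pr X Y (extendAut α))
    (h : (F.prune C P K).Iso X Y σ) : Pr X Y σ := by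
  refine generate_induction hPr (fun g X Y hXY => hE ⊤ (Or.inl rfl) X le_top Y _
    (Iso.conj _ g (by simp)) (Iso.conj _ g hXY)) (fun E α hα X hX Y hXY => ?_) h
  have hiso : (F.prune C P K).Iso E E (extendAut α) := iso_extendAut_iff.2 (mem_aut_generate hα)
  have hisoX := hiso.restrict hX fun s => hXY s
  rcases hα with (⟨β, -, heq⟩ | ⟨β, hβ, heq⟩) | hα
  · cases heq
    exact hE ⊤ (Or.inl rfl) X hX Y _ hiso hisoX
  · cases heq
    exact hK _ hβ X hX Y hisoX
  · obtain ⟨E', hE', β, -, heq⟩ := Set.mem_iUnion₂.1 hα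
    cases heq
    exact hE _ (Or.inr hE') X hX Y _ hiso hisoX

variable [Finite S]

theorem isGeneratedAbove_prune (hP : F.IsCentric P) (hC : ∀ E ∈ C, F.IsCentric E)
    (hKF : K ≤ F.Aut P) (hX : ¬ F.IsCentric X) : (F.prune C P K).IsGeneratedAbove X := by
  intro Pr hPr hext Y Z σ hY hσ
  have hlt {Y E : Subgroup S} (hE : F.IsCentric E) (hY : (F.prune C P K).IsConj X Y)
      (hYE : Y ≤ E) : Y < E := by
    refine lt_of_le_of_ne hYE ?_
    rintro rfl
    exact hX (hE.of_isConj (hY.mono (prune_le hKF)).symm)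
  refine (prune_induction hPr.iso_and_isConj_imp (fun E hE Y hYE Z σ hσE hσ => ?_)
    (fun α hα Y hYP Z hσ => ?_) hσ).2 hY
  · have hEc : F.IsCentric E := by
      rcases hE with rfl | hE
      exacts [isCentric_top F, hC E hE.1]
    exact ⟨hσ, fun hY => hext Y Z E E σ hY (hlt hEc hY hYE) hσ hσE⟩
  · exact ⟨hσ, fun hY => hext Y Z P P _ hY (hlt hP hY hYP) hσ
      (iso_extendAut_iff.2 (le_aut_prune hα))⟩

variable [Fact p.Prime]

theorem aut_prune (hS : IsPGroup p S) (hF : F.IsSaturated p) (hC : F.IsEssentialReps p C)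
    (hPC : P ∈ C) (hHK : F.extAut P ≤ K) (hKF : K ≤ F.Aut P) : (F.prune C P K).Aut P = K := by
  have hP := hC.1 P hPC
  have hPt := hP.2.2.1.isNormalizerTerminal hS (hF P)
  have hle : F.prune C P K ≤ F := prune_le hKF
  have hconj {X Y σ} (hσ : F.Iso X Y σ) (h : F.IsConj X P → F.Transports K X Y σ) :
      F.Transports K X Y σ := by
    by_cases hX : F.IsConj X P
    exacts [h hX, ⟨hσ, fun χ χ' W W' hχ => (hX hχ.isConj).elim⟩]
  refine le_antisymm (fun α hα => ?_) le_aut_prune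
  have htr : F.Transports K P P (extendAut α) := by
    refine prune_induction (isGroupoidal_transports hPt) (fun E hE X hXE Y σ hσE hσ => ?_)
      (fun β hβ X hXP Y hσ => ?_) (iso_extendAut_iff.2 hα)
    · refine hconj (hσ.mono hle) fun hX => .of_extends hS hHK (hσ.mono hle)
        (lt_of_le_of_ne hXE ?_) (hσE.mono hle)
      rintro rfl
      rcases hE with rfl | ⟨hXC, hXP⟩
      · exact hP.1.ne (hX.eq_top rfl)
      · exact hXP ((hC.2 X (hC.1 X hXC)).unique ⟨hXC, .refl F X⟩ ⟨hPC, hX⟩)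
    · refine hconj (hσ.mono hle) fun hX => ?_
      obtain rfl := Subgroup.eq_of_le_of_card_ge hXP hX.card_eq.ge
      obtain rfl := (hσ.mono hle).right_unique (iso_extendAut_iff.2 (hKF hβ))
      exact .of_mem (lt_normalizer hS hP.1) hHK hKF hβ
  obtain ⟨β, hβ, hαβ⟩ := htr.exists_mem
  obtain rfl : α = β := MulEquiv.ext fun x => Subtype.ext (by rw [← hαβ, extendAut_apply])
  exact hβ

theorem prune_iso (hS : IsPGroup p S) (hF : F.IsSaturated p) (hC : F.IsEssentialReps p C)
    (hmin : ∀ Q : Subgroup S, Q < P → ¬ IsSCentric Q) (X : Subgroup S) :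
    ∀ Y σ, F.IsCentric X → ¬ F.IsConj X P → F.Iso X Y σ → (F.prune C P K).Iso X Y σ := by
  induction X using induction_card_gt with | step X ih
  intro Y σ hX hXP hσ
  obtain ⟨E, hXE, hE, hEC⟩ := hC.exists_isFullyNormalized X
  have hEc := hX.of_isConj hXE
  have habove : F.IsLEAbove (F.prune C P K) E := fun X' V W τ hX' hV =>
    ih V ((hXE.trans hX').card_eq.trans_lt (card_lt_card_of_lt hV)) W τ
      ((hEc.of_isConj hX').mono hV.le) ((hEc.of_isConj hX').not_isConj_of_lt hmin hV)
  have haut : F.Aut E ≤ (F.prune C P K).Aut E := by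
    rcases eq_or_ne E ⊤ with rfl | hEtop
    · exact aut_le_aut_prune (Or.inl rfl)
    by_cases hEss : F.IsEssential p E
    · exact aut_le_aut_prune (Or.inr ⟨hEC hEss, by rintro rfl; exact hXP hXE⟩)
    · exact (hE.extAut_eq_aut hS (hF E) (lt_top_iff_ne_top.2 hEtop) hEc hEss).ge.trans
        habove.extAut_le_aut
  exact (hE.isNormalizerTerminal hS (hF E)).iso_of_isLEAbove hS habove haut hXE hσ

theorem isLEAbove_prune (hS : IsPGroup p S) (hF : F.IsSaturated p) (hC : F.IsEssentialReps p C)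
    (hmin : ∀ Q : Subgroup S, Q < P → ¬ IsSCentric Q) (hX : F.IsCentric X) :
    F.IsLEAbove (F.prune C P K) X := fun _ V W σ hY hV =>
  prune_iso hS hF hC hmin V W σ ((hX.of_isConj hY).mono hV.le)
    ((hX.of_isConj hY).not_isConj_of_lt hmin hV)

theorem isCentric_of_isCentric_prune (hS : IsPGroup p S) (hF : F.IsSaturated p)
    (hP : F.IsEssential p P) (hC : F.IsEssentialReps p C)
    (hmin : ∀ Q : Subgroup S, Q < P → ¬ IsSCentric Q) (X : Subgroup S) :
    (F.prune C P K).IsCentric X → F.IsCentric X := by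
  induction X using induction_card_gt with | step X ih
  intro hX
  rcases eq_or_ne X ⊤ with rfl | hXtop
  · exact isCentric_top F
  have hlt := lt_normalizer hS (lt_top_iff_ne_top.2 hXtop)
  have hN : F.IsCentric N[X] := ih _ (card_lt_card_of_lt hlt) (hX.mono hlt.le)
  have hNP : ¬ F.IsConj N[X] P := fun h =>
    hX.not_isConj_of_lt hmin hlt
      ((hP.2.2.1.isNormalizerTerminal hS (hF P) _ h).isConj_of_isLEAbove hS
        (isLEAbove_prune hS hF hC hmin hP.2.1))
  obtain ⟨E, hXE, hE⟩ := F.exists_isFullyNormalized X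
  have hEt := hE.isNormalizerTerminal hS (hF E)
  obtain ⟨σ, W, hσ, hσN⟩ := hEt X hXE
  have hσG := (prune_iso (K := K) hS hF hC hmin _ W σ hN hNP hσN).restrict hlt.le
    fun _ => hσ.mem_iff
  exact fun Y hY => (hEt Y (hY.symm.trans hXE)).isSCentric (hX E hσG.isConj)

theorem isSaturated_prune (hS : IsPGroup p S) (hF : F.IsSaturated p) (hP : F.IsEssential p P)
    (hC : F.IsEssentialReps p C) (hmin : ∀ Q : Subgroup S, Q < P → ¬ IsSCentric Q)
    (hKF : K ≤ F.Aut P) : (F.prune C P K).IsSaturated p := by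
  intro X
  induction X using induction_card_gt with | step X ih
  by_cases hX : F.IsCentric X
  · exact (isLEAbove_prune hS hF hC hmin hX).isSaturatedAt hS (prune_le hKF) (hF X)
  · have hXG : ¬ (F.prune C P K).IsCentric X :=
      fun h => hX (isCentric_of_isCentric_prune hS hF hP hC hmin X h)
    obtain ⟨Y, hXY, hY⟩ : ∃ Y, (F.prune C P K).IsConj X Y ∧ ¬ IsSCentric Y := by
      simpa only [IsCentric, not_forall, exists_prop] using hXG
    exact (isGeneratedAbove_prune hP.2.1 (fun E hE => (hC.1 E hE).2.1) hKF hX).isSaturatedAt hS ih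
      hXY (isSCentric_iff.not.1 hY)

theorem isEssential_prune_iff (hS : IsPGroup p S) (hF : F.IsSaturated p)
    (hC : F.IsEssentialReps p C) (hPC : P ∈ C) (hHK : F.extAut P ≤ K) (hKF : K ≤ F.Aut P) :
    (F.prune C P K).IsEssential p P ↔ F.extAut P < K := by
  obtain ⟨hlt, hc, hN, -⟩ := hC.1 P hPC
  have hK : (F.prune C P K).Aut P = K := aut_prune hS hF hC hPC hHK hKF
  have hle : F.prune C P K ≤ F := prune_le hKF
  obtain ⟨haut, hrec⟩ := hN.isFullyAutomized_and_isReceptive hS (hF P)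
  refine ⟨fun ⟨_, _, _, M, hM⟩ => lt_of_le_of_ne hHK fun heq => ?_, fun h => ?_⟩
  · exact not_isStronglyPEmbedded_of_aut_eq_extAut hS hc.isSCentric (haut.of_le hle)
      (hK.trans heq.symm) M hM
  · exact ⟨hlt, hc.of_le hle, hN.of_le hle, exists_isStronglyPEmbedded hS hlt hc.isSCentric
      (haut.of_le hle) hrec (aut_mono hle P) (hK.symm ▸ h)⟩

end Prune

end FusionSystem

theorem lemma5 (p : ℕ) [Fact p.Prime] {S : Type*} [Group S] [Finite S] (hS : IsPGroup p S)
    (F : FusionSystem S) (hF : F.IsSaturated p)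
    (P : Subgroup S) (hP : F.IsEssential p P)
    (C : Set (Subgroup S)) (hC : F.IsEssentialReps p C) (hPC : P ∈ C)
    (hmin : ∀ Q : Subgroup S, Q < P → ¬ FusionSystem.IsSCentric Q)
    (K : Subgroup (MulAut P)) (hHK : F.extAut P ≤ K) (hKF : K ≤ F.Aut P) :
    (F.prune C P K).IsSaturated p ∧
      ((F.prune C P K).IsEssential p P ↔ F.extAut P < K) ∧
      ((F.prune C P K).IsEssential p P → (F.prune C P K).Aut P = K) :=
  ⟨FusionSystem.isSaturated_prune hS hF hP hC hmin hKF,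
    FusionSystem.isEssential_prune_iff hS hF hC hPC hHK hKF,
    fun _ => FusionSystem.aut_prune hS hF hC hPC hHK hKF⟩
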